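/- **Setting.** Let $d\ge 2$ and let $\mathcal D$ be a zero-mean probability distribution on $\mathbb R^d$ with $\|z\|_2\le\kappa$ for $\mathcal D$-almost every $z$. Put $\Sigma:=\mathbb E_{z\sim\mathcal D}[zz^{\mathsf T}]$, let $\lambda_1\ge\lambda_2\ge\dots\ge\lambda_d$ be the eigenvalues of $\Sigma$, and assume $\mathrm{gap}:=\lambda_1-\lambda_2>0$. Let $\sigma^2$ satisfy $\mathbb E_{z\sim\mathcal D}\|zz^{\mathsf T}-\Sigma\|_F^2\le\sigma^2$. For $w\neq 0$ let $f(w):=\mathbb E_{z\sim\mathcal D}\big[-(w^{\mathsf T}z)^2/\|w\|_2^2\big]$, and let $w^*\in\arg\min_{w\ne0}f(w)$. **Algorithm (DM-Krasulina, no discarded samples).** Let $N\ge1$ be the number of nodes and let $B\ge 1$, a multiple of $N$, be the network-wide mini-batch size. On a probability space $(\Omega,\mathcal F,\mathbb P)$ let $z_1,z_2,\dots$ be i.i.d. with law $\mathcal D$, and let $w_0$ be uniform on the unit sphere of $\mathbb R^d$ and independent of $(z_k)_k$. Write $z_{n,b,t}:=z_{b+(n-1)B/N+(t-1)B}$ for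 $1\le n\le N$, $1\le b\le B/N$, $t\ge1$. With stepsizes $\eta_t$, for $t=1,2,\dots$ let $$\xi_{n,t}:=\frac1{B/N}\sum_{b=1}^{B/N}\Big(z_{n,b,t}z_{n,b,t}^{\mathsf T}w_{t-1}-\frac{w_{t-1}^{\mathsf T}z_{n,b,t}z_{n,b,t}^{\mathsf T}w_{t-1}}{\|w_{t-1}\|_2^2}\,w_{t-1}\Big),\qquad w_t:=w_{t-1}+\eta_t\,\frac1N\sum_{n=1}^N\xi_{n,t}.$$ Let $\sigma_B^2:=\mathbb E\big\|\frac1B\sum_{n=1}^N\sum_{b=1}^{B/N}z_{n,b,t}z_{n,b,t}^{\mathsf T}-\Sigma\big\|_F^2$ (independent of $t$). **Parameters.** Fix $\delta\in(0,1)$, $c_0>2$, $c:=c_0/(2\,\mathrm{gap})$, and put $$Q_1:=\frac{64\,e\,d\,\kappa^4\max(1,c^2)}{\delta^2}\ln\frac4\delta,\qquad Q_2:=\frac{512\,e^2d^2\sigma_B^2\max(1,c^2)}{\delta^4}\ln\frac4\delta .$$ Let $Q_1'\ge Q_1$ and $Q_2'\ge Q_2/\sigma_B^2$ (if $\sigma_B^2=0$,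 the latter means $Q_2'\ge0$), $Q:=Q_1'+\sigma_B^2Q_2'$, and $\eta_t:=c/(Q+t)$. For $q>0$ put $$C_1(q):=\frac{\lambda_1}2\Big(\frac{4ed}{\delta^2}\Big)^{\frac5{2\ln2}}e^{2c^2\lambda_1^2/q},\qquad C_2(q):=\frac{2c^2\lambda_1e^{(c_0+2c^2\lambda_1^2)/q}}{c_0-2},$$ and $C_1:=C_1(Q)$, $C_2:=C_2(Q)$. **Claim.** There are events $\Omega_1'\supseteq\Omega_2'\supseteq\cdots$ with $\mathbb P\big(\bigcap_{t>0}\Omega_t'\big)\ge1-\delta$ such that for every $t\ge1$ for which $t':=tB$ satisfies $B\le(t')^{1-2/c_0}$, $$\mathbb E[f(w_t)\mid\Omega_t']-f(w^*)\;\le\;c_0C_1\frac{Q_1'^{\,c_0/2}}{t'}+c_0C_1\Big(\frac{\sigma^2Q_2'}{t'}\Big)^{c_0/2}+\frac{C_2\sigma^2}{t'} .$$ In particular the left-hand side is $O(1/t')$: it is at most $K/t'$ with $$K:=c_0C_1(Q_1')\,Q_1'^{\,c_0/2}+c_0C_1(Q_1')\,(\sigma^2Q_2')^{c_0/2}+C_2(Q_1')\,\sigma^2,$$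 an expression in which $t$, $N$ and $B$ do not occur. -/

import Mathlib

open MeasureTheory ProbabilityTheory

noncomputable section

namespace DMKrasulina

variable {d : ℕ}

/-- `ℝ^d` with the Euclidean norm. -/
abbrev Vec (d : ℕ) : Type := EuclideanSpace ℝ (Fin d)

/-- The rank-one matrix `z zᵀ`. -/
def outer (z : Vec d) : Matrix (Fin d) (Fin d) ℝ := Matrix.of fun i j => z i * z j

/-- The covariance matrix `Σ = E_{z ∼ D} [z zᵀ]` of a zero-mean distribution `D`. -/
def cov (D : Measure (Vec d)) : Matrix (Fin d) (Fin d) ℝ :=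
  Matrix.of fun i j => ∫ z, outer z i j ∂D

theorem cov_isHermitian (D : Measure (Vec d)) : (cov D).IsHermitian := by
  ext i j
  simp [cov, outer, mul_comm]

/-- The `k`-th largest eigenvalue (counted with multiplicity, `k = 1, …, d`) of the covariance
matrix. The covariance matrix is positive semidefinite, so ordering the eigenvalues by value and by
magnitude is the same. -/
def eigval (D : Measure (Vec d)) (k : ℕ) : ℝ :=
  if h : k - 1 < d then
    (cov_isHermitian D).eigenvalues₀ ⟨k - 1, by simpa using h⟩
  else 0

/-- The eigengap `λ₁(Σ) - λ₂(Σ)`. -/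
def gap (D : Measure (Vec d)) : ℝ := eigval D 1 - eigval D 2

/-- The squared Frobenius norm. -/
def frobSq (M : Matrix (Fin d) (Fin d) ℝ) : ℝ := ∑ i, ∑ j, M i j ^ 2

/-- The single-sample covariance noise `E_{z ∼ D} ‖z zᵀ - Σ‖_F²`. -/
def sampleVar (D : Measure (Vec d)) : ℝ := ∫ z, frobSq (outer z - cov D) ∂D

/-- `σ_B²`: the variance of the mini-batch sample covariance computed from `B` independent samples
with law `D`, spread evenly over `N` nodes. -/
def batchVar (D : Measure (Vec d)) (N B : ℕ) : ℝ :=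
  ∫ x, frobSq ((1 / (B : ℝ)) • (∑ n : Fin N, ∑ b : Fin (B / N), outer (x (n, b))) - cov D)
    ∂(Measure.pi fun _ : Fin N × Fin (B / N) => D)

/-- The loss function of the 1-PCA problem, `-(wᵀ z zᵀ w) / ‖w‖²`. -/
def loss (w z : Vec d) : ℝ := -((inner ℝ w z) ^ 2 / ‖w‖ ^ 2)

/-- The statistical risk `f(w) = E_{z ∼ D} [ℓ(w, z)]`. -/
def risk (D : Measure (Vec d)) (w : Vec d) : ℝ := ∫ z, loss w z ∂D

/-- The pseudo-gradient `z zᵀ w - (wᵀ z zᵀ w / ‖w‖²) w` of a single sample. -/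
def pseudoGrad (w z : Vec d) : Vec d :=
  (inner ℝ z w) • z - ((inner ℝ w z) ^ 2 / ‖w‖ ^ 2) • w

/-- The `b`-th sample that node `n` receives in data-splitting round `t + 1`. All indices start at
`0`, so `z k` is the sample that arrives at time `k + 1`. No sample of the stream is discarded. -/
def splitSample (N B : ℕ) (z : ℕ → Vec d) (t : ℕ) (n : Fin N) (b : Fin (B / N)) : Vec d :=
  z (b + n * (B / N) + t * B)

/-- The local average `ξ_{n,t+1}` of the pseudo-gradients over the mini-batch of node `n`. -/
def localDir (N B : ℕ) (z : ℕ → Vec d) (t : ℕ) (w : Vec d) (n : Fin N) : Vec d :=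
  (1 / ((B / N : ℕ) : ℝ)) • ∑ b : Fin (B / N), pseudoGrad w (splitSample N B z t n b)

/-- The iterates `w_t` of DM-Krasulina: `N` nodes, network-wide mini-batch size `B`, stepsizes
`η_1, η_2, …`, initialization `w0`, data stream `z`, exact averaging over the nodes. -/
def iterate (N B : ℕ) (η : ℕ → ℝ) (w0 : Vec d) (z : ℕ → Vec d) : ℕ → Vec d
  | 0 => w0
  | t + 1 =>
    iterate N B η w0 z t +
      η (t + 1) • ((1 / (N : ℝ)) • ∑ n : Fin N, localDir N B z t (iterate N B η w0 z t) n)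

/-- The uniform probability distribution on the unit sphere of `ℝ^d`, as a measure on `ℝ^d`. -/
def uniformSphere (d : ℕ) : Measure (Vec d) :=
  (((volume : Measure (Vec d)).toSphere Set.univ)⁻¹ • (volume : Measure (Vec d)).toSphere).map
    Subtype.val

/-- The conditional expected excess risk `E[f(w) | A] - f(w*)` of a random model `w`, given an
event `A` of positive probability. -/
def condExcessRisk {Ω : Type*} [MeasurableSpace Ω] (P : Measure Ω) (A : Set Ω)
    (D : Measure (Vec d)) (w : Ω → Vec d) (wstar : Vec d) : ℝ :=
  (∫ ω, risk D (w ω) ∂(P[|A])) - risk D wstar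

/-- `Q₁ = (64 e d κ⁴ max(1, c²) / δ²) ln(4/δ)`. -/
def Q₁ (d : ℕ) (κ c δ : ℝ) : ℝ :=
  64 * Real.exp 1 * d * κ ^ 4 * max 1 (c ^ 2) / δ ^ 2 * Real.log (4 / δ)

/-- `Q₂ = (512 e² d² σ_B² max(1, c²) / δ⁴) ln(4/δ)`, where `v` stands for `σ_B²`. -/
def Q₂ (d : ℕ) (v c δ : ℝ) : ℝ :=
  512 * Real.exp 1 ^ 2 * d ^ 2 * v * max 1 (c ^ 2) / δ ^ 4 * Real.log (4 / δ)

/-- `C₁ = (λ₁/2) (4 e d / δ²)^{5/(2 ln 2)} e^{2 c² λ₁² / Q}`. -/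
def C₁ (d : ℕ) (lam c δ Q : ℝ) : ℝ :=
  lam / 2 * (4 * Real.exp 1 * d / δ ^ 2) ^ (5 / (2 * Real.log 2)) *
    Real.exp (2 * c ^ 2 * lam ^ 2 / Q)

/-- `C₂ = 2 c² λ₁ e^{(c₀ + 2 c² λ₁²)/Q} / (c₀ - 2)`. -/
def C₂ (lam c₀ c Q : ℝ) : ℝ :=
  2 * c ^ 2 * lam * Real.exp ((c₀ + 2 * c ^ 2 * lam ^ 2) / Q) / (c₀ - 2)

end DMKrasulina

end

/-! Let `e` be a top unit eigenvector, `λ` and `g` the top eigenvalue and the gap, and `s_t = sinSq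
e w_t`. The excess risk is at most `λ s_t`, so it suffices to control `s_t`. Averaging over nodes is
the same as averaging over the whole batch (`iterate_succ_eq`), and the batch covariance has
variance `σ_B² ≤ σ² / B` (`covNoise_eq`).

Alignment. Every update is orthogonal to the current iterate, so `‖w_t‖²` never decreases, and since
`∑ η_t² ≤ c² / Q` it grows by at most 1% in total. The coordinate `⟨e, w_t⟩` is multiplied by `1 + η
(λ - Rayleigh quotient)` and perturbed by a martingale increment. With `a = δ / (2 √(e d))`, the
uniform start satisfies `|⟨e, w_0⟩| ≥ a` up to probability `δ / 2` (`uniformSphere_slab_le`), and by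
Kolmogorov's inequality the accumulated noise stays below `a / 16` for all time up to another `δ /
2` (`measure_stoppedNoise_gt_le`). On the remaining event the coordinate grows at rate at least `η g
/ 4` while `s_t ≥ 1/4`; hence after a deterministic burn-in `T`, `s_t ≤ 1/3` for ever
(`sinSq_le_third`).

Rate. The events are `Ω'_t = {s_r ≤ 1/3 for T ≤ r < t}`. They are decided before `w_t` is drawn, and
on them the drift `-2 η g s (1 - s)` is at most `-(4/3) η g s`. Shrinking the event only discards
large values of `s`, so the conditional means obey a linear recursion (`condSinSq_succ_le`). Its
solution is of order `((Q + T) / (Q + t)) ^ α + σ_B² / (Q + t)` with `α = (4/3) (c₀ / 2)`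
(`le_of_contraction`).

Constants. `exists_burn_in_time` bounds `((Q + T) / Q) ^ α` by a power of `4 e d / δ²`. The surplus
of `α` over `c₀ / 2` pays for splitting `Q` into its two summands (`rpow_div_add_le_add`), and the
restriction on `B` turns `t ^ (-c₀ / 2)` into `1 / (t B)` (`rate_le`). -/

namespace DMKrasulina

variable {d : ℕ}

/-! ### Spectral estimates for the covariance operator. -/

/-- The covariance matrix as an operator on Euclidean space. -/
noncomputable def covOp (D : Measure (Vec d)) : Vec d →ₗ[ℝ] Vec d :=
  Matrix.toEuclideanLin (cov D)

theorem covOp_apply (D : Measure (Vec d)) (w : Vec d) (i : Fin d) :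
    covOp D w i = ∑ j, cov D i j * w j := by
  simp [covOp, Matrix.mulVec, dotProduct]

theorem inner_eq_sum (x y : Vec d) : inner ℝ x y = ∑ i, x i * y i := by
  simp [PiLp.inner_apply, mul_comm]

theorem abs_coord_le (x : Vec d) (i : Fin d) : |x i| ≤ ‖x‖ := by
  simpa using PiLp.norm_apply_le x i

theorem integrable_of_ae_bound {α : Type*} [MeasurableSpace α] {μ : Measure α}
    [IsFiniteMeasure μ] {f : α → ℝ} (hf : Measurable f) (C : ℝ) (h : ∀ᵐ x ∂μ, |f x| ≤ C) :
    Integrable f μ :=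
  Integrable.of_bound hf.aestronglyMeasurable C (by simpa using h)

theorem integrable_outer {D : Measure (Vec d)} [IsProbabilityMeasure D] {κ : ℝ}
    (hκ : ∀ᵐ x ∂D, ‖x‖ ≤ κ) (i j : Fin d) : Integrable (fun z : Vec d => outer z i j) D := by
  refine integrable_of_ae_bound (C := κ * κ) ?_ ?_
  · simp only [outer, Matrix.of_apply]; fun_prop
  · filter_upwards [hκ] with x hx
    simp only [outer, Matrix.of_apply, abs_mul]
    exact mul_le_mul ((abs_coord_le x i).trans hx) ((abs_coord_le x j).trans hx) (abs_nonneg _)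
      ((norm_nonneg x).trans hx)

theorem inner_mul_inner_eq_sum_outer (z w y : Vec d) :
    inner ℝ z w * inner ℝ z y = ∑ i, ∑ j, outer z i j * (w j * y i) := by
  simp only [inner_eq_sum, outer, Matrix.of_apply]
  rw [mul_comm, Finset.sum_mul_sum]
  refine Finset.sum_congr rfl fun i _ => Finset.sum_congr rfl fun j _ => by ring

theorem inner_covOp {D : Measure (Vec d)} [IsProbabilityMeasure D] {κ : ℝ}
    (hκ : ∀ᵐ x ∂D, ‖x‖ ≤ κ) (w y : Vec d) :
    ∫ z, inner ℝ z w * inner ℝ z y ∂D = inner ℝ (covOp D w) y := by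
  simp only [inner_mul_inner_eq_sum_outer]
  rw [integral_finsetSum _ fun i _ => integrable_finsetSum _ fun j _ =>
    (integrable_outer hκ i j).mul_const _, inner_eq_sum]
  refine Finset.sum_congr rfl fun i _ => ?_
  rw [integral_finsetSum _ fun j _ => (integrable_outer hκ i j).mul_const _, covOp_apply,
    Finset.sum_mul]
  refine Finset.sum_congr rfl fun j _ => ?_
  rw [integral_mul_const]
  simp [cov, mul_assoc]

theorem inner_covOp_self {D : Measure (Vec d)} [IsProbabilityMeasure D] {κ : ℝ}
    (hκ : ∀ᵐ x ∂D, ‖x‖ ≤ κ) (w : Vec d) :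
    ∫ z, (inner ℝ w z) ^ 2 ∂D = inner ℝ w (covOp D w) := by
  rw [real_inner_comm, ← inner_covOp hκ]
  refine integral_congr_ae (.of_forall fun z => ?_)
  simp only [real_inner_comm w z]; ring

theorem inner_covOp_self_nonneg {D : Measure (Vec d)} [IsProbabilityMeasure D] {κ : ℝ}
    (hκ : ∀ᵐ x ∂D, ‖x‖ ≤ κ) (w : Vec d) : 0 ≤ inner ℝ w (covOp D w) := by
  rw [← inner_covOp_self hκ]
  exact integral_nonneg fun z => sq_nonneg _

theorem inner_covOp_self_le {D : Measure (Vec d)} [IsProbabilityMeasure D] {κ : ℝ}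
    (hκ : ∀ᵐ x ∂D, ‖x‖ ≤ κ) (w : Vec d) : inner ℝ w (covOp D w) ≤ κ ^ 2 * ‖w‖ ^ 2 := by
  rw [← inner_covOp_self hκ]
  have hb : ∀ᵐ z ∂D, (inner ℝ w z) ^ 2 ≤ κ ^ 2 * ‖w‖ ^ 2 := by
    filter_upwards [hκ] with z hz
    have h1 := abs_real_inner_le_norm w z
    have h2 : |inner ℝ w z| ≤ κ * ‖w‖ := h1.trans (by nlinarith [norm_nonneg w])
    rw [← sq_abs, ← mul_pow]
    exact pow_le_pow_left₀ (abs_nonneg _) h2 2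
  have := integral_mono_ae (μ := D) (f := fun z => (inner ℝ w z) ^ 2)
    (g := fun _ => κ ^ 2 * ‖w‖ ^ 2) ?_ (integrable_const _) hb
  · simpa using this
  · refine integrable_of_ae_bound (by fun_prop) (κ ^ 2 * ‖w‖ ^ 2) ?_
    filter_upwards [hb] with z hz
    rwa [abs_of_nonneg (sq_nonneg _)]

theorem covOp_symm (D : Measure (Vec d)) (x y : Vec d) :
    inner ℝ (covOp D x) y = inner ℝ x (covOp D y) :=
  Matrix.isSymmetric_toEuclideanLin_iff.mpr (cov_isHermitian D) x y

/-- `e` is a unit eigenvector of `S` for the eigenvalue `lam`, and on its orthogonal complement the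
spectrum of `S` lies between `0` and `lam - g`. -/
structure IsTopEigenvector (S : Vec d →ₗ[ℝ] Vec d) (e : Vec d) (lam g : ℝ) : Prop where
  norm_eq : ‖e‖ = 1
  apply_eq : S e = lam • e
  symm : ∀ x y, inner ℝ (S x) y = inner ℝ x (S y)
  gap_mul_le : ∀ w, g * (‖w‖ ^ 2 - (inner ℝ e w) ^ 2) ≤ lam * ‖w‖ ^ 2 - inner ℝ w (S w)
  le_mul : ∀ w, lam * ‖w‖ ^ 2 - inner ℝ w (S w) ≤ lam * (‖w‖ ^ 2 - (inner ℝ e w) ^ 2)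
  norm_sub_sq_le : ∀ w, ‖S w - lam • w‖ ^ 2 ≤ lam ^ 2 * (‖w‖ ^ 2 - (inner ℝ e w) ^ 2)

/-- In eigenbasis coordinates the `e`-term drops out of `λ‖w‖² - ⟨w, Σ w⟩`, and the other squares
carry weights `λ₁ - λ_i`, which lie between the gap and `λ₁` because the eigenvalues are
nonnegative. -/
theorem exists_isTopEigenvector {D : Measure (Vec d)} [IsProbabilityMeasure D] {κ : ℝ}
    (hκ : ∀ᵐ x ∂D, ‖x‖ ≤ κ) (hd : 2 ≤ d) :
    ∃ e, IsTopEigenvector (covOp D) e (eigval D 1) (gap D) := by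
  set hA := cov_isHermitian D
  set b := hA.eigenvectorBasis
  -- The reindexing by which `eigenvalues` is defined from the sorted `eigenvalues₀`, so that `heig`
  -- is definitional.
  set E : Fin (Fintype.card (Fin d)) ≃ Fin d := Fintype.equivOfCardEq (Fintype.card_fin _)
  have hcard : Fintype.card (Fin d) = d := Fintype.card_fin d
  set z0 : Fin (Fintype.card (Fin d)) := ⟨0, by omega⟩
  set z1 : Fin (Fintype.card (Fin d)) := ⟨1, by omega⟩
  have h1 : eigval D 1 = hA.eigenvalues₀ z0 := by
    simp only [eigval]; rw [dif_pos (by omega)]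
  have h2 : eigval D 2 = hA.eigenvalues₀ z1 := by
    simp only [eigval]; rw [dif_pos (by omega)]
  have heig : ∀ i, hA.eigenvalues i = hA.eigenvalues₀ (E.symm i) := fun i => rfl
  have happly : ∀ i, covOp D (b i) = hA.eigenvalues i • b i := by
    intro i
    have := hA.mulVec_eigenvectorBasis i
    simp only [covOp, Matrix.toLpLin_apply]
    rw [this]; rfl
  have hbn : ∀ i, ‖b i‖ = 1 := fun i => b.orthonormal.1 i
  set e := b (E z0)
  have hle : ∀ i, i ≠ E z0 → hA.eigenvalues i ≤ eigval D 2 := by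
    intro i hi
    rw [heig, h2]
    apply hA.eigenvalues₀_antitone
    have : E.symm i ≠ z0 := fun h => hi (by rw [← h]; simp)
    rw [Fin.le_def]
    have h' : (E.symm i : ℕ) ≠ 0 := fun h => this (Fin.ext h)
    show 1 ≤ (E.symm i : ℕ)
    omega
  have hnn : ∀ i, 0 ≤ hA.eigenvalues i := by
    intro i
    have := inner_covOp_self_nonneg hκ (b i)
    rw [happly, inner_smul_right, real_inner_self_eq_norm_sq, hbn] at this
    simpa using this
  have he1 : hA.eigenvalues (E z0) = eigval D 1 := by rw [heig, h1]; simp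
  have hle1 : ∀ i, hA.eigenvalues i ≤ eigval D 1 := by
    intro i
    rw [heig, h1]
    exact hA.eigenvalues₀_antitone (Fin.le_def.2 (Nat.zero_le _))
  have hcoef : ∀ w i, inner ℝ (b i) (covOp D w) = hA.eigenvalues i * inner ℝ (b i) w := by
    intro w i
    rw [← covOp_symm, happly, inner_smul_left]; simp
  have hns : ∀ w : Vec d, ‖w‖ ^ 2 = ∑ i, (inner ℝ (b i) w) ^ 2 := by
    intro w
    rw [← b.sum_sq_norm_inner_right w]
    simp
  have hq : ∀ w, inner ℝ w (covOp D w) = ∑ i, hA.eigenvalues i * (inner ℝ (b i) w) ^ 2 := by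
    intro w
    rw [← b.sum_inner_mul_inner w (covOp D w)]
    refine Finset.sum_congr rfl fun i _ => ?_
    rw [hcoef, real_inner_comm]; ring
  have hperp : ∀ w, ‖w‖ ^ 2 - (inner ℝ e w) ^ 2 =
      ∑ i ∈ Finset.univ.erase (E z0), (inner ℝ (b i) w) ^ 2 := by
    intro w
    rw [hns, ← Finset.add_sum_erase _ _ (Finset.mem_univ (E z0))]; ring
  have hdiff : ∀ w, eigval D 1 * ‖w‖ ^ 2 - inner ℝ w (covOp D w) =
      ∑ i ∈ Finset.univ.erase (E z0), (eigval D 1 - hA.eigenvalues i) * (inner ℝ (b i) w) ^ 2 := by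
    intro w
    rw [hq, hns, Finset.mul_sum, ← Finset.sum_sub_distrib,
      ← Finset.add_sum_erase _ _ (Finset.mem_univ (E z0)), he1, sub_self, zero_add]
    refine Finset.sum_congr rfl fun i _ => by ring
  refine ⟨e, hbn _, by rw [happly, he1], covOp_symm D, ?_, ?_, ?_⟩
  · intro w
    rw [hdiff, hperp, Finset.mul_sum]
    refine Finset.sum_le_sum fun i hi => ?_
    have := hle i (Finset.ne_of_mem_erase hi)
    refine mul_le_mul_of_nonneg_right ?_ (sq_nonneg _)
    simp only [gap]; linarith
  · intro w
    rw [hdiff, hperp, Finset.mul_sum]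
    refine Finset.sum_le_sum fun i hi => ?_
    refine mul_le_mul_of_nonneg_right ?_ (sq_nonneg _)
    linarith [hnn i]
  · intro w
    rw [hperp, hns, ← Finset.add_sum_erase _ _ (Finset.mem_univ (E z0)), Finset.mul_sum]
    have hc : ∀ i, inner ℝ (b i) (covOp D w - eigval D 1 • w) =
        (hA.eigenvalues i - eigval D 1) * inner ℝ (b i) w := by
      intro i
      rw [inner_sub_right, hcoef, inner_smul_right]; ring
    simp only [hc]
    rw [he1, sub_self]
    simp only [zero_mul, ne_eq, OfNat.ofNat_ne_zero, not_false_eq_true, zero_pow, zero_add]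
    refine Finset.sum_le_sum fun i _ => ?_
    rw [mul_pow]
    refine mul_le_mul_of_nonneg_right ?_ (sq_nonneg _)
    have h3 := hnn i; have h4 := hle1 i
    nlinarith

theorem eigval_one_le_sq {D : Measure (Vec d)} [IsProbabilityMeasure D] {κ : ℝ}
    (hκ : ∀ᵐ x ∂D, ‖x‖ ≤ κ) {e : Vec d} {lam g : ℝ} (h : IsTopEigenvector (covOp D) e lam g) :
    lam ≤ κ ^ 2 := by
  have := inner_covOp_self_le hκ e
  rw [h.apply_eq, inner_smul_right, real_inner_self_eq_norm_sq, h.norm_eq] at this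
  simpa using this

/-- The eigengap is at most the top eigenvalue. -/
theorem IsTopEigenvector.gap_le {S : Vec d →ₗ[ℝ] Vec d} {e : Vec d} {lam g : ℝ}
    (h : IsTopEigenvector S e lam g) (hd : 2 ≤ d) : g ≤ lam := by
  have : Nontrivial (Fin d) := Fin.nontrivial_iff_two_le.2 hd
  obtain ⟨w, hw0, hw⟩ : ∃ w : Vec d, w ≠ 0 ∧ inner ℝ e w = 0 := by
    by_contra! hcon
    obtain ⟨i, j, hij⟩ := exists_pair_ne (Fin d)
    -- Orthogonal to `e` by cancellation; if it vanishes then `e j = 0` and the `j`-th basis vector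
    -- serves instead.
    set w : Vec d := e j • EuclideanSpace.single i (1 : ℝ) - e i • EuclideanSpace.single j (1 : ℝ)
    have hwe : inner ℝ e w = 0 := by
      simp [w, inner_sub_right, inner_smul_right, EuclideanSpace.inner_single_right]
      ring
    by_cases hw : w = 0
    · have hj : e j = 0 := by
        have := congrArg (fun x : Vec d => x i) hw
        simpa [w, hij, hij.symm] using this
      refine hcon (EuclideanSpace.single j 1) ?_ ?_
      · simp
      · simp [EuclideanSpace.inner_single_right, hj]
    · exact hcon w hw hwe
  have h1 := (h.gap_mul_le w).trans (h.le_mul w)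
  rw [hw] at h1
  have : 0 < ‖w‖ ^ 2 := by positivity
  have h2 : g * ‖w‖ ^ 2 ≤ lam * ‖w‖ ^ 2 := by simpa using h1
  exact le_of_mul_le_mul_right h2 this

end DMKrasulina

/-! ### Moments of the mini-batch pseudo-gradient. -/

namespace DMKrasulina

variable {d : ℕ}

/-- The component of `y` orthogonal to `w`. -/
noncomputable def orthPart (w y : Vec d) : Vec d := y - (inner ℝ w y / ‖w‖ ^ 2) • w

theorem inner_orthPart_self (w y : Vec d) : inner ℝ w (orthPart w y) = 0 := by
  by_cases hw : w = 0
  · simp [hw]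
  · have : ‖w‖ ≠ 0 := norm_ne_zero_iff.2 hw
    rw [orthPart, inner_sub_right, inner_smul_right, real_inner_self_eq_norm_sq]
    field_simp; ring

/-- Self-adjointness of the projection moves it onto the test vector, after which `⟨y, batchDir w
x⟩` is a plain average of products `⟨x i, w⟩ ⟨x i, y'⟩`. -/
theorem inner_orthPart_comm (w x y : Vec d) :
    inner ℝ x (orthPart w y) = inner ℝ y (orthPart w x) := by
  simp only [orthPart, inner_sub_right, inner_smul_right, real_inner_comm x y,
    real_inner_comm x w, real_inner_comm y w]
  ring

theorem norm_orthPart_sq_le (w y : Vec d) : ‖orthPart w y‖ ^ 2 ≤ ‖y‖ ^ 2 := by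
  have h : y = orthPart w y + (inner ℝ w y / ‖w‖ ^ 2) • w := by simp [orthPart]
  have h2 : inner ℝ (orthPart w y) ((inner ℝ w y / ‖w‖ ^ 2) • w) = 0 := by
    rw [inner_smul_right, real_inner_comm w (orthPart w y), inner_orthPart_self, mul_zero]
  have h3 := norm_add_sq_real (orthPart w y) ((inner ℝ w y / ‖w‖ ^ 2) • w)
  rw [← h, h2] at h3
  nlinarith [sq_nonneg ‖(inner ℝ w y / ‖w‖ ^ 2) • w‖]

theorem orthPart_sub (w x y : Vec d) : orthPart w (x - y) = orthPart w x - orthPart w y := by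
  simp only [orthPart, inner_sub_right, sub_div, sub_smul]; abel

theorem orthPart_smul_self (w : Vec d) (a : ℝ) : orthPart w (a • w) = 0 := by
  by_cases hw : w = 0
  · simp [hw, orthPart]
  · have : ‖w‖ ≠ 0 := norm_ne_zero_iff.2 hw
    rw [orthPart, inner_smul_right, real_inner_self_eq_norm_sq, mul_div_assoc,
      div_self (pow_ne_zero 2 this), mul_one, sub_self]

section Batch

variable {ι : Type*} [Fintype ι]

/-- The sample covariance matrix of a batch. -/
noncomputable def sampleCov (x : ι → Vec d) : Matrix (Fin d) (Fin d) ℝ :=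
  (1 / (Fintype.card ι : ℝ)) • ∑ i, outer (x i)

/-- The mean pseudo-gradient over a batch. -/
noncomputable def batchDir (w : Vec d) (x : ι → Vec d) : Vec d :=
  (1 / (Fintype.card ι : ℝ)) • ∑ i, pseudoGrad w (x i)

/-- The expected pseudo-gradient. -/
noncomputable def meanDir (D : Measure (Vec d)) (w : Vec d) : Vec d := orthPart w (covOp D w)

theorem sampleCov_apply (x : ι → Vec d) (w : Vec d) :
    Matrix.toEuclideanLin (sampleCov x) w =
      (1 / (Fintype.card ι : ℝ)) • ∑ i, (inner ℝ (x i) w) • x i := by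
  ext k
  simp only [Matrix.toLpLin_apply, Matrix.mulVec, dotProduct, sampleCov, Matrix.smul_apply,
    Matrix.sum_apply, outer, Matrix.of_apply, inner_eq_sum, smul_eq_mul, PiLp.smul_apply,
    WithLp.ofLp_sum, Finset.sum_apply]
  simp only [mul_assoc, ← Finset.mul_sum, Finset.sum_mul]
  congr 1
  rw [Finset.sum_comm]
  refine Finset.sum_congr rfl fun i _ => ?_
  refine Finset.sum_congr rfl fun j _ => by ring

/-- The pseudo-gradient is linear in `z zᵀ`, so a batch acts only through its sample covariance.
Orthogonality to `w` and the Frobenius bound on the noise both follow from this form. -/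
theorem batchDir_eq (w : Vec d) (x : ι → Vec d) :
    batchDir w x = orthPart w (Matrix.toEuclideanLin (sampleCov x) w) := by
  rw [sampleCov_apply, orthPart, batchDir, inner_smul_right, inner_sum]
  simp only [pseudoGrad, Finset.sum_sub_distrib, smul_sub, inner_smul_right]
  congr 1
  rw [← Finset.sum_smul, smul_smul]
  congr 1
  rw [mul_div_assoc, Finset.sum_div]
  congr 1
  refine Finset.sum_congr rfl fun i _ => ?_
  rw [real_inner_comm w (x i)]; ring

theorem batchDir_sub_meanDir (D : Measure (Vec d)) (w : Vec d) (x : ι → Vec d) :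
    batchDir w x - meanDir D w =
      orthPart w (Matrix.toEuclideanLin (sampleCov x - cov D) w) := by
  rw [batchDir_eq, meanDir, ← orthPart_sub, covOp, map_sub, LinearMap.sub_apply]

theorem inner_batchDir_self (w : Vec d) (x : ι → Vec d) : inner ℝ w (batchDir w x) = 0 := by
  rw [batchDir_eq, inner_orthPart_self]

theorem norm_toEuclideanLin_sq_le (M : Matrix (Fin d) (Fin d) ℝ) (w : Vec d) :
    ‖Matrix.toEuclideanLin M w‖ ^ 2 ≤ frobSq M * ‖w‖ ^ 2 := by
  rw [EuclideanSpace.norm_sq_eq, EuclideanSpace.norm_sq_eq, frobSq, Finset.sum_mul]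
  refine Finset.sum_le_sum fun i _ => ?_
  simp only [Real.norm_eq_abs, sq_abs, Matrix.toLpLin_apply, Matrix.mulVec, dotProduct]
  exact Finset.sum_mul_sq_le_sq_mul_sq _ _ _

theorem norm_batchDir_sub_sq_le (D : Measure (Vec d)) (w : Vec d) (x : ι → Vec d) :
    ‖batchDir w x - meanDir D w‖ ^ 2 ≤ frobSq (sampleCov x - cov D) * ‖w‖ ^ 2 := by
  rw [batchDir_sub_meanDir]
  exact (norm_orthPart_sq_le _ _).trans (norm_toEuclideanLin_sq_le _ _)

theorem norm_batchDir_le [Nonempty ι] {κ : ℝ} (w : Vec d) (x : ι → Vec d)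
    (hx : ∀ i, ‖x i‖ ≤ κ) : ‖batchDir w x‖ ≤ κ ^ 2 * ‖w‖ := by
  have h1 : ‖batchDir w x‖ ≤ ‖Matrix.toEuclideanLin (sampleCov x) w‖ := by
    rw [batchDir_eq]
    exact le_of_sq_le_sq (norm_orthPart_sq_le _ _) (norm_nonneg _)
  refine h1.trans ?_
  have hc : (0 : ℝ) < Fintype.card ι := by exact_mod_cast Fintype.card_pos
  rw [sampleCov_apply, norm_smul, Real.norm_of_nonneg (by positivity)]
  have h2 : ‖∑ i, (inner ℝ (x i) w) • x i‖ ≤ Fintype.card ι * (κ ^ 2 * ‖w‖) := by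
    refine (norm_sum_le _ _).trans ?_
    refine (Finset.sum_le_card_nsmul _ _ (κ ^ 2 * ‖w‖) fun i _ => ?_).trans (by simp)
    rw [norm_smul, Real.norm_eq_abs]
    have h3 := abs_real_inner_le_norm (x i) w
    have h4 := hx i
    have h5 := norm_nonneg (x i)
    calc |inner ℝ (x i) w| * ‖x i‖ ≤ (‖x i‖ * ‖w‖) * ‖x i‖ := by gcongr
      _ = ‖x i‖ ^ 2 * ‖w‖ := by ring
      _ ≤ κ ^ 2 * ‖w‖ := by gcongr
  calc 1 / (Fintype.card ι : ℝ) * ‖∑ i, (inner ℝ (x i) w) • x i‖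
      ≤ 1 / (Fintype.card ι : ℝ) * (Fintype.card ι * (κ ^ 2 * ‖w‖)) := by gcongr
    _ = κ ^ 2 * ‖w‖ := by field_simp

theorem measurable_batchDir {α : Type*} [MeasurableSpace α] {X : α → Vec d} {Y : α → ι → Vec d}
    (hX : Measurable X) (hY : Measurable Y) : Measurable fun a => batchDir (X a) (Y a) := by
  simp only [batchDir, pseudoGrad]
  fun_prop

theorem measurable_meanDir (D : Measure (Vec d)) : Measurable (meanDir D) := by
  have : Measurable (covOp D) := (covOp D).continuous_of_finiteDimensional.measurable
  unfold meanDir orthPart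
  fun_prop

variable {D : Measure (Vec d)} [IsProbabilityMeasure D] {κ : ℝ}

theorem ae_pi_norm_le (hκ : ∀ᵐ x ∂D, ‖x‖ ≤ κ) :
    ∀ᵐ x ∂(Measure.pi fun _ : ι => D), ∀ i, ‖x i‖ ≤ κ := by
  rw [ae_all_iff]
  intro i
  exact (measurePreserving_eval (fun _ : ι => D) i).quasiMeasurePreserving.ae hκ

theorem integral_pi_eval {f : Vec d → ℝ} (i : ι) (hf : Measurable f) :
    ∫ x, f (x i) ∂(Measure.pi fun _ : ι => D) = ∫ z, f z ∂D := by
  have h := measurePreserving_eval (fun _ : ι => D) i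
  have h2 := integral_map (μ := Measure.pi fun _ : ι => D) (φ := Function.eval i) (f := f)
    h.measurable.aemeasurable hf.aestronglyMeasurable
  rw [h.map_eq] at h2
  exact h2.symm

theorem integral_inner_batchDir [Nonempty ι] (hκ : ∀ᵐ x ∂D, ‖x‖ ≤ κ) (y w : Vec d) :
    ∫ x, inner ℝ y (batchDir w x) ∂(Measure.pi fun _ : ι => D) = inner ℝ y (meanDir D w) := by
  have hc : (Fintype.card ι : ℝ) ≠ 0 := by exact_mod_cast Fintype.card_ne_zero
  set y' := orthPart w y
  have h1 : ∀ x : ι → Vec d, inner ℝ y (batchDir w x) =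
      (1 / (Fintype.card ι : ℝ)) * ∑ i, inner ℝ (x i) w * inner ℝ (x i) y' := by
    intro x
    rw [batchDir_eq, inner_orthPart_comm, sampleCov_apply, inner_smul_left, sum_inner]
    simp [inner_smul_left, y']
  simp only [h1]
  rw [integral_const_mul, integral_finsetSum]
  · have h2 : ∀ i : ι, ∫ x, inner ℝ (x i) w * inner ℝ (x i) y' ∂(Measure.pi fun _ : ι => D) =
        inner ℝ (covOp D w) y' := by
      intro i
      rw [integral_pi_eval (f := fun z => inner ℝ z w * inner ℝ z y') i (by fun_prop),
        inner_covOp hκ]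
    simp only [h2, Finset.sum_const, Finset.card_univ, nsmul_eq_mul]
    rw [meanDir, inner_orthPart_comm]
    field_simp
  · intro i _
    refine integrable_of_ae_bound (by fun_prop) (κ * ‖w‖ * (κ * ‖y'‖)) ?_
    filter_upwards [ae_pi_norm_le hκ] with x hx
    have hk : 0 ≤ κ := (norm_nonneg _).trans (hx i)
    rw [abs_mul]
    exact mul_le_mul ((abs_real_inner_le_norm _ _).trans (by gcongr; exact hx i))
      ((abs_real_inner_le_norm _ _).trans (by gcongr; exact hx i)) (abs_nonneg _) (by positivity)

/-- The mean squared Frobenius error of the sample covariance of a batch indexed by `ι`. -/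
noncomputable def covNoise (D : Measure (Vec d)) (ι : Type*) [Fintype ι] : ℝ :=
  ∫ x, frobSq (sampleCov x - cov D) ∂(Measure.pi fun _ : ι => D)

theorem frobSq_nonneg (M : Matrix (Fin d) (Fin d) ℝ) : 0 ≤ frobSq M :=
  Finset.sum_nonneg fun _ _ => Finset.sum_nonneg fun _ _ => sq_nonneg _

theorem covNoise_nonneg (D : Measure (Vec d)) (ι : Type*) [Fintype ι] : 0 ≤ covNoise D ι := integral_nonneg fun _ => frobSq_nonneg _

theorem memLp_outer_sub (hκ : ∀ᵐ x ∂D, ‖x‖ ≤ κ) (i j : Fin d) :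
    MemLp (fun z : Vec d => outer z i j - cov D i j) 2 D := by
  refine MemLp.of_bound (C := κ * κ + |cov D i j|) ?_ ?_
  · simp only [outer, Matrix.of_apply]
    exact Measurable.aestronglyMeasurable (by fun_prop)
  · filter_upwards [hκ] with x hx
    rw [Real.norm_eq_abs]
    refine (abs_sub _ _).trans ?_
    gcongr
    simp only [outer, Matrix.of_apply, abs_mul]
    exact mul_le_mul ((abs_coord_le x i).trans hx) ((abs_coord_le x j).trans hx) (abs_nonneg _)
      ((norm_nonneg x).trans hx)

theorem integral_outer_sub (hκ : ∀ᵐ x ∂D, ‖x‖ ≤ κ) (i j : Fin d) :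
    ∫ z, (outer z i j - cov D i j) ∂D = 0 := by
  rw [integral_sub (integrable_outer hκ i j) (integrable_const _)]
  simp [cov]

theorem sampleCov_sub_apply [Nonempty ι] (D : Measure (Vec d)) (x : ι → Vec d) (i j : Fin d) :
    (sampleCov x - cov D) i j =
      (1 / (Fintype.card ι : ℝ)) * ∑ k, (outer (x k) i j - cov D i j) := by
  have hc : (Fintype.card ι : ℝ) ≠ 0 := by exact_mod_cast Fintype.card_ne_zero
  simp only [sampleCov, Matrix.sub_apply, Matrix.smul_apply, Matrix.sum_apply, smul_eq_mul,
    Finset.sum_sub_distrib, Finset.sum_const, Finset.card_univ, nsmul_eq_mul, mul_sub]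
  field_simp

theorem memLp_sampleCov_sub [Nonempty ι] (hκ : ∀ᵐ x ∂D, ‖x‖ ≤ κ) (i j : Fin d) :
    MemLp (fun x : ι → Vec d => (sampleCov x - cov D) i j) 2 (Measure.pi fun _ : ι => D) := by
  have h : MemLp (fun x : ι → Vec d => ∑ k, (outer (x k) i j - cov D i j)) 2
      (Measure.pi fun _ : ι => D) :=
    memLp_finsetSum _ fun k _ =>
      (memLp_outer_sub hκ i j).comp_measurePreserving (measurePreserving_eval (fun _ : ι => D) k)
  simpa only [sampleCov_sub_apply] using h.const_mul (1 / (Fintype.card ι : ℝ))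

theorem integrable_frobSq_sampleCov [Nonempty ι] (hκ : ∀ᵐ x ∂D, ‖x‖ ≤ κ) :
    Integrable (fun x : ι → Vec d => frobSq (sampleCov x - cov D))
      (Measure.pi fun _ : ι => D) :=
  integrable_finsetSum _ fun i _ => integrable_finsetSum _ fun j _ =>
    (memLp_sampleCov_sub hκ i j).integrable_sq

/-- The centred entries at different batch positions are independent, so their variances add; the
factor `1 / card²` leaves `1 / card`. -/
theorem integral_sampleCov_sub_sq [Nonempty ι] (hκ : ∀ᵐ x ∂D, ‖x‖ ≤ κ) (i j : Fin d) :
    ∫ x, ((sampleCov x - cov D) i j) ^ 2 ∂(Measure.pi fun _ : ι => D) =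
      (∫ z, (outer z i j - cov D i j) ^ 2 ∂D) / Fintype.card ι := by
  have hc : (Fintype.card ι : ℝ) ≠ 0 := by exact_mod_cast Fintype.card_ne_zero
  set X : Vec d → ℝ := fun z => outer z i j - cov D i j
  have hX := memLp_outer_sub hκ i j
  have hX0 := integral_outer_sub hκ i j
  have hmX : Measurable X := by
    simp only [X, outer, Matrix.of_apply]; fun_prop
  have hv := variance_sum_pi (μ := fun _ : ι => D) (X := fun _ : ι => X) (fun _ => hX)
  have hY : MemLp (∑ k, fun x : ι → Vec d => X (x k)) 2 (Measure.pi fun _ : ι => D) :=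
    memLp_finsetSum' _ fun k _ =>
      hX.comp_measurePreserving (measurePreserving_eval (fun _ : ι => D) k)
  have hY0 : ∫ x, (∑ k, fun x : ι → Vec d => X (x k)) x ∂(Measure.pi fun _ : ι => D) = 0 := by
    simp only [Finset.sum_apply]
    rw [integral_finsetSum]
    · refine Finset.sum_eq_zero fun k _ => ?_
      rw [integral_pi_eval k hmX, hX0]
    · exact fun k _ => (hX.comp_measurePreserving
        (measurePreserving_eval (fun _ : ι => D) k)).integrable one_le_two
  rw [variance_of_integral_eq_zero hY.aemeasurable hY0] at hv
  rw [show Var[X; D] = ∫ z, X z ^ 2 ∂D from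
    variance_of_integral_eq_zero hX.aemeasurable hX0] at hv
  simp only [Finset.sum_apply, Finset.sum_const, Finset.card_univ, nsmul_eq_mul] at hv
  simp only [sampleCov_sub_apply, mul_pow, integral_const_mul]
  rw [hv]
  simp only [X]
  field_simp

theorem covNoise_eq [Nonempty ι] (hκ : ∀ᵐ x ∂D, ‖x‖ ≤ κ) :
    covNoise D ι = sampleVar D / Fintype.card ι := by
  simp only [covNoise, sampleVar, frobSq, Matrix.sub_apply (outer _)]
  rw [integral_finsetSum _ fun i _ => integrable_finsetSum _ fun j _ =>
    (memLp_sampleCov_sub hκ i j).integrable_sq, integral_finsetSum _ fun i _ =>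
    integrable_finsetSum _ fun j _ => (memLp_outer_sub hκ i j).integrable_sq, Finset.sum_div]
  refine Finset.sum_congr rfl fun i _ => ?_
  rw [integral_finsetSum _ fun j _ => (memLp_sampleCov_sub hκ i j).integrable_sq,
    integral_finsetSum _ fun j _ => (memLp_outer_sub hκ i j).integrable_sq, Finset.sum_div]
  exact Finset.sum_congr rfl fun j _ => integral_sampleCov_sub_sq hκ i j

theorem integrable_norm_batchDir_sub_sq [Nonempty ι] (hκ : ∀ᵐ x ∂D, ‖x‖ ≤ κ) (w : Vec d) :
    Integrable (fun x : ι → Vec d => ‖batchDir w x - meanDir D w‖ ^ 2)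
      (Measure.pi fun _ : ι => D) := by
  have hm := measurable_batchDir (ι := ι) (measurable_const (a := w)) measurable_id
  refine ((integrable_frobSq_sampleCov hκ).mul_const (‖w‖ ^ 2)).mono'
    ((hm.sub_const _).norm.pow_const 2).aestronglyMeasurable (.of_forall fun x => ?_)
  rw [Real.norm_of_nonneg (sq_nonneg _)]
  exact norm_batchDir_sub_sq_le D w x

theorem integral_norm_batchDir_sub_sq_le [Nonempty ι] (hκ : ∀ᵐ x ∂D, ‖x‖ ≤ κ) (w : Vec d) :
    ∫ x, ‖batchDir w x - meanDir D w‖ ^ 2 ∂(Measure.pi fun _ : ι => D) ≤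
      covNoise D ι * ‖w‖ ^ 2 := by
  rw [covNoise, ← integral_mul_const]
  exact integral_mono (integrable_norm_batchDir_sub_sq hκ w)
    ((integrable_frobSq_sampleCov hκ).mul_const _) fun x => norm_batchDir_sub_sq_le D w x

theorem integrable_inner_batchDir [Nonempty ι] (hκ : ∀ᵐ x ∂D, ‖x‖ ≤ κ) (y w : Vec d) :
    Integrable (fun x : ι → Vec d => inner ℝ y (batchDir w x)) (Measure.pi fun _ : ι => D) := by
  have hm := measurable_batchDir (ι := ι) (measurable_const (a := w)) measurable_id
  refine integrable_of_ae_bound (measurable_const.inner hm) (‖y‖ * (κ ^ 2 * ‖w‖)) ?_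
  filter_upwards [ae_pi_norm_le hκ] with x hx
  exact (abs_real_inner_le_norm _ _).trans (by gcongr; exact norm_batchDir_le w x hx)

theorem integrable_norm_batchDir_sq [Nonempty ι] (hκ : ∀ᵐ x ∂D, ‖x‖ ≤ κ) (w : Vec d) :
    Integrable (fun x : ι → Vec d => ‖batchDir w x‖ ^ 2) (Measure.pi fun _ : ι => D) := by
  have hm := measurable_batchDir (ι := ι) (measurable_const (a := w)) measurable_id
  refine integrable_of_ae_bound (hm.norm.pow_const 2) ((κ ^ 2 * ‖w‖) ^ 2) ?_
  filter_upwards [ae_pi_norm_le hκ] with x hx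
  rw [abs_of_nonneg (sq_nonneg _)]
  gcongr
  exact norm_batchDir_le w x hx

theorem integral_norm_batchDir_sq_le [Nonempty ι] (hκ : ∀ᵐ x ∂D, ‖x‖ ≤ κ) (w : Vec d) :
    ∫ x, ‖batchDir w x‖ ^ 2 ∂(Measure.pi fun _ : ι => D) ≤
      ‖meanDir D w‖ ^ 2 + covNoise D ι * ‖w‖ ^ 2 := by
  -- Bias–variance split: the second bracket is affine in `batchDir` and integrates to `‖meanDir‖²`.
  have h1 : ∀ x : ι → Vec d, ‖batchDir w x‖ ^ 2 = ‖batchDir w x - meanDir D w‖ ^ 2 +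
      (2 * inner ℝ (meanDir D w) (batchDir w x) - ‖meanDir D w‖ ^ 2) := by
    intro x
    rw [norm_sub_sq_real, real_inner_comm]; ring
  simp only [h1]
  have h2 : Integrable (fun x : ι → Vec d => 2 * inner ℝ (meanDir D w) (batchDir w x) -
      ‖meanDir D w‖ ^ 2) (Measure.pi fun _ : ι => D) :=
    ((integrable_inner_batchDir hκ _ _).const_mul 2).sub (integrable_const _)
  rw [integral_add (integrable_norm_batchDir_sub_sq hκ w) h2,
    integral_sub ((integrable_inner_batchDir hκ _ _).const_mul 2) (integrable_const _),
    integral_const_mul, integral_inner_batchDir hκ, real_inner_self_eq_norm_sq]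
  have := integral_norm_batchDir_sub_sq_le (ι := ι) hκ w
  simp only [integral_const, probReal_univ, one_smul]
  linarith

theorem integral_inner_batchDir_sub_sq_le [Nonempty ι] (hκ : ∀ᵐ x ∂D, ‖x‖ ≤ κ) {e : Vec d}
    (he : ‖e‖ = 1) (w : Vec d) :
    ∫ x, (inner ℝ e (batchDir w x - meanDir D w)) ^ 2 ∂(Measure.pi fun _ : ι => D) ≤
      covNoise D ι * ‖w‖ ^ 2 := by
  refine le_trans ?_ (integral_norm_batchDir_sub_sq_le hκ w)
  refine integral_mono_of_nonneg (.of_forall fun x => sq_nonneg _)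
    (integrable_norm_batchDir_sub_sq hκ w) (.of_forall fun x => ?_)
  have := abs_real_inner_le_norm e (batchDir w x - meanDir D w)
  rw [he, one_mul] at this
  simp only
  rw [← sq_abs]
  exact pow_le_pow_left₀ (abs_nonneg _) this 2

end Batch

section MeanDir

variable {D : Measure (Vec d)} {e : Vec d} {lam g : ℝ}

/-- The projection kills `λ w`, and `Σ w - λ w` has no `e`-component. The factor `sin²` gained here
keeps the second-order drift from adding a constant that survives at the optimum. -/
theorem norm_meanDir_sq_le (h : IsTopEigenvector (covOp D) e lam g) (w : Vec d) :
    ‖meanDir D w‖ ^ 2 ≤ lam ^ 2 * (‖w‖ ^ 2 - (inner ℝ e w) ^ 2) := by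
  have : meanDir D w = orthPart w (covOp D w - lam • w) := by
    rw [orthPart_sub, orthPart_smul_self, sub_zero, meanDir]
  rw [this]
  exact (norm_orthPart_sq_le _ _).trans (h.norm_sub_sq_le w)

/-- The `e`-coordinate feeds back on itself multiplicatively; the rate `λ` minus the Rayleigh
quotient is at least `g * sinSq`, hence nonnegative. -/
theorem inner_meanDir (h : IsTopEigenvector (covOp D) e lam g) (w : Vec d) :
    inner ℝ e (meanDir D w) = inner ℝ e w * (lam - inner ℝ w (covOp D w) / ‖w‖ ^ 2) := by
  rw [meanDir, orthPart, inner_sub_right, inner_smul_right, ← h.symm, h.apply_eq, inner_smul_left]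
  simp only [conj_trivial]; ring

end MeanDir

end DMKrasulina

/-! ### Anti-concentration of the uniform law on the sphere. -/

namespace DMKrasulina

variable {d : ℕ}

theorem norm_stretch_sq {e : Vec d} (he : ‖e‖ = 1) (s : ℝ) (y : Vec d) :
    ‖y + ((s - 1) * inner ℝ e y) • e‖ ^ 2 =
      ‖y‖ ^ 2 - (inner ℝ e y) ^ 2 + s ^ 2 * (inner ℝ e y) ^ 2 := by
  rw [norm_add_sq_real, inner_smul_right, norm_smul, he, real_inner_comm, mul_one,
    Real.norm_eq_abs, sq_abs]
  ring

/-- The part of the unit ball in a slab of half-width `a` fills at most a fraction `a √(e d)` of the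
ball: stretching it across the slab by `1 / (a √d)` keeps it within the ball of radius
`√(1 + 1 / d)`. -/
theorem volume_ball_inter_slab_le (hd : 0 < d) {e : Vec d} (he : ‖e‖ = 1) {a : ℝ} (ha : 0 < a) :
    volume (Metric.ball (0 : Vec d) 1 ∩ {y | |inner ℝ e y| < a}) ≤
      ENNReal.ofReal (a * √d * Real.exp (1 / 2)) * volume (Metric.ball (0 : Vec d) 1) := by
  have hd' : (0 : ℝ) < d := by exact_mod_cast hd
  have hsd : 0 < √(d : ℝ) := Real.sqrt_pos.2 hd'
  set s : ℝ := 1 / (a * √d) with hs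
  have hs0 : 0 < s := by positivity
  set K := Metric.ball (0 : Vec d) 1 ∩ {y | |inner ℝ e y| < a}
  -- `T` multiplies the `e`-component by `s` and fixes the orthogonal complement; as a transvection
  -- its determinant is `1 + f e = s`.
  set f : Module.Dual ℝ (Vec d) := (s - 1) • (innerSL ℝ e).toLinearMap
  set T := LinearMap.transvection f e
  have hT : ∀ y, T y = y + ((s - 1) * inner ℝ e y) • e := by
    intro y; simp [T, f, LinearMap.transvection.apply]
  have hdet : LinearMap.det T = s := by
    simp only [T, LinearMap.transvection.det]
    simp [f, he]
  set ρ : ℝ := √(1 + 1 / d)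
  have hρ : 0 < ρ := Real.sqrt_pos.2 (by positivity)
  have hsub : T '' K ⊆ Metric.ball (0 : Vec d) ρ := by
    rintro _ ⟨y, ⟨hy1, hy2⟩, rfl⟩
    rw [mem_ball_zero_iff] at hy1 ⊢
    refine Real.lt_sqrt_of_sq_lt ?_
    rw [hT, norm_stretch_sq he]
    have h1 : ‖y‖ ^ 2 < 1 := by nlinarith [norm_nonneg y]
    have h2 : (inner ℝ e y) ^ 2 ≤ a ^ 2 := by
      rw [← sq_abs]; exact pow_le_pow_left₀ (abs_nonneg _) (le_of_lt hy2) 2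
    have h3 : s ^ 2 * (inner ℝ e y) ^ 2 ≤ 1 / (d : ℝ) := by
      calc s ^ 2 * (inner ℝ e y) ^ 2 ≤ s ^ 2 * a ^ 2 := by gcongr
        _ = 1 / (d : ℝ) := by
          rw [hs, div_pow, mul_pow, Real.sq_sqrt hd'.le]; field_simp
    nlinarith [sq_nonneg (inner ℝ e y)]
  have hvol := measure_mono (μ := volume) hsub
  rw [Measure.addHaar_image_linearMap, hdet, abs_of_pos hs0,
    Measure.addHaar_ball_of_pos _ _ hρ] at hvol
  -- `(1 + 1/d) ^ (d/2) ≤ e ^ (1/2)`.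
  have hpow : ρ ^ Module.finrank ℝ (Vec d) ≤ Real.exp (1 / 2) := by
    rw [finrank_euclideanSpace_fin]
    have h1 : ρ ≤ Real.exp (1 / (2 * d)) := by
      refine Real.sqrt_le_iff.2 ⟨(Real.exp_pos _).le, ?_⟩
      rw [← Real.exp_nat_mul]
      have := Real.add_one_le_exp (1 / (d : ℝ))
      calc 1 + 1 / (d : ℝ) ≤ Real.exp (1 / d) := by linarith
        _ = _ := by congr 1; push_cast; field_simp
    calc ρ ^ d ≤ Real.exp (1 / (2 * d)) ^ d := by gcongr
      _ = Real.exp (1 / 2) := by rw [← Real.exp_nat_mul]; congr 1; field_simp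
  have hinv : ENNReal.ofReal (a * √d) * ENNReal.ofReal s = 1 := by
    rw [← ENNReal.ofReal_mul (by positivity), hs, mul_one_div_cancel (by positivity),
      ENNReal.ofReal_one]
  calc volume K = ENNReal.ofReal (a * √d) * (ENNReal.ofReal s * volume K) := by
        rw [← mul_assoc, hinv, one_mul]
    _ ≤ ENNReal.ofReal (a * √d) * (ENNReal.ofReal (Real.exp (1 / 2)) *
          volume (Metric.ball (0 : Vec d) 1)) := by
        refine mul_le_mul_right (hvol.trans ?_) _
        gcongr
    _ = _ := by rw [← mul_assoc, ← ENNReal.ofReal_mul (by positivity)]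

open scoped Pointwise in
-- Surface measure is `d` times the volume of the cone over a set, and with radii below `1` the cone
-- over a spherical slab stays in the solid slab.
theorem uniformSphere_slab_le (hd : 0 < d) {e : Vec d} (he : ‖e‖ = 1) {a : ℝ} (ha : 0 < a) :
    uniformSphere d {w | |inner ℝ e w| < a} ≤ ENNReal.ofReal (a * √d * Real.exp (1 / 2)) := by
  have hm : MeasurableSet {w : Vec d | |inner ℝ e w| < a} :=
    measurableSet_lt (by fun_prop) measurable_const
  have hm' : MeasurableSet ((Subtype.val : Metric.sphere (0 : Vec d) 1 → Vec d) ⁻¹'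
    {w : Vec d | |inner ℝ e w| < a}) := measurable_subtype_coe hm
  rw [uniformSphere, Measure.map_apply measurable_subtype_coe hm, Measure.smul_apply, smul_eq_mul,
    Measure.toSphere_apply' _ hm', Measure.toSphere_apply_univ]
  set V := volume (Metric.ball (0 : Vec d) 1)
  have hV0 : V ≠ 0 := (Metric.measure_ball_pos _ _ one_pos).ne'
  have hVt : V ≠ ⊤ := measure_ball_lt_top.ne
  have hsub : Set.Ioo (0 : ℝ) 1 • ((Subtype.val : Metric.sphere (0 : Vec d) 1 → Vec d) ''
      (Subtype.val ⁻¹' {w : Vec d | |inner ℝ e w| < a})) ⊆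
      Metric.ball (0 : Vec d) 1 ∩ {y | |inner ℝ e y| < a} := by
    rintro _ ⟨r, ⟨hr0, hr1⟩, _, ⟨x, hx, rfl⟩, rfl⟩
    have hx1 : ‖(x : Vec d)‖ = 1 := by simp
    simp only [Set.mem_preimage, Set.mem_ofPred_eq] at hx
    constructor
    · rw [mem_ball_zero_iff]
      simpa [norm_smul, hx1, abs_of_pos hr0] using hr1
    · simp only [Set.mem_ofPred_eq, inner_smul_right, abs_mul, abs_of_pos hr0]
      nlinarith [abs_nonneg (inner ℝ e (x : Vec d))]
  have h := (measure_mono (μ := volume) hsub).trans (volume_ball_inter_slab_le hd he ha)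
  have hn0 : (Module.finrank ℝ (Vec d) : ENNReal) ≠ 0 := by
    simp [hd.ne']
  have hnt : (Module.finrank ℝ (Vec d) : ENNReal) ≠ ⊤ := ENNReal.natCast_ne_top _
  calc _ ≤ (Module.finrank ℝ (Vec d) * V)⁻¹ * (Module.finrank ℝ (Vec d) *
        (ENNReal.ofReal (a * √d * Real.exp (1 / 2)) * V)) := by gcongr
    _ = ((Module.finrank ℝ (Vec d) * V)⁻¹ * (Module.finrank ℝ (Vec d) * V)) *
        ENNReal.ofReal (a * √d * Real.exp (1 / 2)) := by ring
    _ = _ := by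
      rw [ENNReal.inv_mul_cancel (mul_ne_zero hn0 hV0) (ENNReal.mul_ne_top hnt hVt), one_mul]

theorem ae_uniformSphere_norm_eq (d : ℕ) : ∀ᵐ w ∂(uniformSphere d), ‖w‖ = 1 := by
  rw [uniformSphere, ae_map_iff measurable_subtype_coe.aemeasurable
    (measurableSet_eq_fun (by fun_prop) measurable_const)]
  exact .of_forall fun x => by simp

end DMKrasulina

/-! ### The sample stream as fresh batches independent of the past. -/

namespace DMKrasulina

section History

variable {Ω : Type*} {d : ℕ} {z : ℕ → Ω → Vec d} {w0 : Ω → Vec d}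

/-- The information in the initialization and the first `n` samples. -/
@[reducible]
def history (w0 : Ω → Vec d) (z : ℕ → Ω → Vec d) (n : ℕ) : MeasurableSpace Ω :=
  MeasurableSpace.comap (fun ω => (w0 ω, fun k : Finset.range n => z k ω)) inferInstance

theorem measurable_history_init (n : ℕ) : Measurable[history w0 z n] w0 :=
  measurable_fst.comp (comap_measurable fun ω => (w0 ω, fun k : Finset.range n => z k ω))

theorem measurable_history_sample {n k : ℕ} (hk : k < n) : Measurable[history w0 z n] (z k) :=
  ((measurable_pi_apply (⟨k, Finset.mem_range.2 hk⟩ : Finset.range n)).comp measurable_snd).comp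
    (comap_measurable fun ω => (w0 ω, fun k : Finset.range n => z k ω))

theorem history_mono {m n : ℕ} (h : m ≤ n) : history w0 z m ≤ history w0 z n := by
  have : Measurable[history w0 z n] fun ω => (w0 ω, fun k : Finset.range m => z k ω) := by
    let _ := history w0 z n
    exact Measurable.prodMk (measurable_history_init n) (measurable_pi_iff.2 fun k =>
      measurable_history_sample ((Finset.mem_range.1 k.2).trans_le h))
  exact this.comap_le

/-- The batch of round `t`. -/
def batch (N B : ℕ) (z : ℕ → Ω → Vec d) (t : ℕ) (ω : Ω) : Fin N × Fin (B / N) → Vec d :=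
  fun i => splitSample N B (fun k => z k ω) t i.1 i.2

theorem splitIndex_lt {N B : ℕ} (hNB : N ∣ B) (i : Fin N × Fin (B / N)) :
    (i.2 : ℕ) + i.1 * (B / N) < B := by
  obtain ⟨q, rfl⟩ := hNB
  obtain ⟨a, b⟩ := i
  have hN : 0 < N := a.pos
  have hb := b.2
  have ha := a.2
  have hq : N * q / N = q := Nat.mul_div_cancel_left _ hN
  simp only [hq]
  have hb' : (b : ℕ) < q := hb.trans_eq hq
  nlinarith

/-- The offset `b + n (B / N)` is a two-digit expansion in base `B / N`, so division recovers the
node. Distinct positions thus use distinct samples, which makes a batch i.i.d. -/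
theorem splitIndex_injective (N B t : ℕ) : Function.Injective fun i : Fin N × Fin (B / N) =>
    (i.2 : ℕ) + i.1 * (B / N) + t * B := by
  rintro ⟨a, b⟩ ⟨a', b'⟩ h
  simp only [add_left_inj] at h
  have hb := b.2
  have hb' := b'.2
  have hq : 0 < B / N := b.pos
  have h1 : (a : ℕ) = a' := by
    have := congrArg (· / (B / N)) h
    simpa [Nat.add_mul_div_right _ _ hq, Nat.div_eq_of_lt hb, Nat.div_eq_of_lt hb'] using this
  rw [h1] at h
  exact Prod.ext (Fin.ext h1) (Fin.ext (by simpa using h))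

variable (N B : ℕ) (η : ℕ → ℝ)

/-- All nodes hold equally many samples, so the average of local averages is one average over the
batch: the network disappears from the analysis here. -/
theorem iterate_succ_eq (t : ℕ) (ω : Ω) :
    iterate N B η (w0 ω) (fun k => z k ω) (t + 1) =
      iterate N B η (w0 ω) (fun k => z k ω) t +
        η (t + 1) • batchDir (iterate N B η (w0 ω) (fun k => z k ω) t) (batch N B z t ω) := by
  rw [iterate]
  congr 2
  have hc : (Fintype.card (Fin N × Fin (B / N)) : ℝ) = N * ((B / N : ℕ) : ℝ) := by
    simp only [Fintype.card_prod, Fintype.card_fin, Nat.cast_mul]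
  simp only [batchDir, localDir, batch, hc, Fintype.sum_prod_type, ← Finset.smul_sum, smul_smul]
  congr 1
  rw [one_div_mul_one_div]

theorem measurable_iterate (hNB : N ∣ B) (t : ℕ) :
    Measurable[history w0 z (t * B)] fun ω => iterate N B η (w0 ω) (fun k => z k ω) t := by
  induction t with
  | zero => exact measurable_history_init _
  | succ t ih =>
    simp only [iterate_succ_eq N B η]
    let _ := history w0 z ((t + 1) * B)
    have h1 : Measurable fun ω => iterate N B η (w0 ω) (fun k => z k ω) t :=
      ih.mono (history_mono (Nat.mul_le_mul_right _ (Nat.le_succ t))) le_rfl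
    have h2 : Measurable fun ω => batch N B z t ω := by
      refine measurable_pi_iff.2 fun i => measurable_history_sample ?_
      have := splitIndex_lt hNB i
      rw [add_mul, one_mul]; omega
    have h3 := measurable_batchDir h1 h2
    fun_prop

end History

variable {Ω : Type*} [mΩ : MeasurableSpace Ω] {P : Measure Ω} [IsProbabilityMeasure P]

/-- If `X` is independent of `(Y, Z)` and `Y` of `Z`, then `(X, Y)` is independent of `Z`. -/
theorem indepFun_prodMk_left {α β γ : Type*} [MeasurableSpace α] [MeasurableSpace β]
    [MeasurableSpace γ] {X : Ω → α} {Y : Ω → β} {Z : Ω → γ} (hX : Measurable X)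
    (hY : Measurable Y) (hZ : Measurable Z) (h : IndepFun X (fun ω => (Y ω, Z ω)) P)
    (h' : IndepFun Y Z P) : IndepFun (fun ω => (X ω, Y ω)) Z P := by
  have := Measure.isProbabilityMeasure_map (μ := P) hX.aemeasurable
  have := Measure.isProbabilityMeasure_map (μ := P) hY.aemeasurable
  have := Measure.isProbabilityMeasure_map (μ := P) hZ.aemeasurable
  rw [indepFun_iff_map_prod_eq_prod_map_map hX.aemeasurable (hY.prodMk hZ).aemeasurable] at h
  have hXY : IndepFun X Y P := by
    rw [indepFun_iff_map_prod_eq_prod_map_map hX.aemeasurable hY.aemeasurable]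
    have h1 : P.map (fun ω => (X ω, Y ω)) =
        (P.map fun ω => (X ω, (Y ω, Z ω))).map (Prod.map id Prod.fst) := by
      rw [Measure.map_map (by fun_prop) (hX.prodMk (hY.prodMk hZ))]; rfl
    rw [h1, h, ← Measure.map_prod_map _ _ measurable_id measurable_fst, Measure.map_id,
      Measure.map_map measurable_fst (hY.prodMk hZ)]
    rfl
  rw [indepFun_iff_map_prod_eq_prod_map_map hY.aemeasurable hZ.aemeasurable] at h'
  rw [indepFun_iff_map_prod_eq_prod_map_map hX.aemeasurable hY.aemeasurable] at hXY
  rw [indepFun_iff_map_prod_eq_prod_map_map (hX.prodMk hY).aemeasurable hZ.aemeasurable, hXY]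
  -- The law of the triple is a product of three laws; only its bracketing has to be changed.
  have h2 : P.map (fun ω => ((X ω, Y ω), Z ω)) =
      (P.map fun ω => (X ω, (Y ω, Z ω))).map MeasurableEquiv.prodAssoc.symm := by
    rw [Measure.map_map (MeasurableEquiv.measurable _) (hX.prodMk (hY.prodMk hZ))]; rfl
  rw [h2, h, h']
  exact ((measurePreserving_prodAssoc (P.map X) (P.map Y) (P.map Z)).symm
    MeasurableEquiv.prodAssoc).map_eq

/-- `Y 0, Y 1, …` have law `ν`, are adapted to the (shifted) filtration `ℱ`, and each `Y t` is
independent of the past `ℱ t`. -/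
structure IsInnovation {F : Type*} [MeasurableSpace F] (P : Measure Ω) (ν : Measure F)
    (ℱ : ℕ → MeasurableSpace Ω) (Y : ℕ → Ω → F) : Prop where
  mono : Monotone ℱ
  le : ∀ t, ℱ t ≤ mΩ
  measurable : ∀ t, Measurable[ℱ (t + 1)] (Y t)
  law : ∀ t, P.map (Y t) = ν
  indep : ∀ t, Indep (ℱ t) (MeasurableSpace.comap (Y t) inferInstance) P

theorem IsInnovation.measurable' {F : Type*} [MeasurableSpace F] {P : Measure Ω} {ν : Measure F}
    {ℱ : ℕ → MeasurableSpace Ω} {Y : ℕ → Ω → F} (h : IsInnovation P ν ℱ Y) (t : ℕ) :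
    Measurable (Y t) :=
  (h.measurable t).mono (h.le _) le_rfl

section Freeze

variable {F : Type*} [MeasurableSpace F] {ν : Measure F}
  {ℱ : ℕ → MeasurableSpace Ω} {Y : ℕ → Ω → F} {E : Type*} [MeasurableSpace E] {X : Ω → E}
  {t : ℕ}

/-- A past-measurable state and the next batch have a product law, so Fubini's theorem can stand in
for conditional expectation. -/
theorem IsInnovation.map_prod (h : IsInnovation P ν ℱ Y) (hX : Measurable[ℱ t] X) :
    P.map (fun ω => (X ω, Y t ω)) = (P.map X).prod ν := by
  have hX' : Measurable X := hX.mono (h.le t) le_rfl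
  have hi : IndepFun X (Y t) P := by
    rw [IndepFun_iff_Indep]
    exact indep_of_indep_of_le_left (h.indep t) hX.comap_le
  rw [(indepFun_iff_map_prod_eq_prod_map_map hX'.aemeasurable
    (h.measurable' t).aemeasurable).1 hi, h.law]

variable [IsProbabilityMeasure ν]

/-- Integrating out the innovation while the past is frozen. -/
theorem IsInnovation.integral_eq (h : IsInnovation P ν ℱ Y) (hX : Measurable[ℱ t] X)
    {φ : E × F → ℝ} (hφ : Measurable φ) (hInt : Integrable (fun ω => φ (X ω, Y t ω)) P) :
    ∫ ω, φ (X ω, Y t ω) ∂P = ∫ ω, ∫ y, φ (X ω, y) ∂ν ∂P := by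
  have hX' : Measurable X := hX.mono (h.le t) le_rfl
  have := Measure.isProbabilityMeasure_map (μ := P) hX'.aemeasurable
  have hXY : Measurable fun ω => (X ω, Y t ω) := hX'.prodMk (h.measurable' t)
  have hi : Integrable φ ((P.map X).prod ν) := by
    rw [← h.map_prod hX]
    exact (integrable_map_measure hφ.aestronglyMeasurable hXY.aemeasurable).2 hInt
  rw [← integral_map (φ := fun ω => (X ω, Y t ω)) hXY.aemeasurable hφ.aestronglyMeasurable,
    h.map_prod hX, integral_prod _ hi,
    integral_map hX'.aemeasurable hi.integral_prod_left.aestronglyMeasurable]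

theorem IsInnovation.integrable_integral (h : IsInnovation P ν ℱ Y) (hX : Measurable[ℱ t] X)
    {φ : E × F → ℝ} (hφ : Measurable φ) (hInt : Integrable (fun ω => φ (X ω, Y t ω)) P) :
    Integrable (fun ω => ∫ y, φ (X ω, y) ∂ν) P := by
  have hX' : Measurable X := hX.mono (h.le t) le_rfl
  have := Measure.isProbabilityMeasure_map (μ := P) hX'.aemeasurable
  have hXY : Measurable fun ω => (X ω, Y t ω) := hX'.prodMk (h.measurable' t)
  have hi : Integrable φ ((P.map X).prod ν) := by
    rw [← h.map_prod hX]
    exact (integrable_map_measure hφ.aestronglyMeasurable hXY.aemeasurable).2 hInt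
  exact (integrable_map_measure hi.integral_prod_left.aestronglyMeasurable hX'.aemeasurable).1
    hi.integral_prod_left

end Freeze

section Stream

variable {d : ℕ} {D : Measure (Vec d)} {z : ℕ → Ω → Vec d}
  {w0 : Ω → Vec d}

theorem history_le (hz : ∀ k, Measurable (z k)) (hw0 : Measurable w0) (n : ℕ) :
    history w0 z n ≤ mΩ :=
  have h : Measurable fun ω => (w0 ω, fun k : Finset.range n => z k ω) :=
    hw0.prodMk (measurable_pi_iff.2 fun k => hz k)
  h.comap_le

theorem isInnovation_batch (hz : ∀ k, Measurable (z k)) (hzlaw : ∀ k, P.map (z k) = D)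
    (hzindep : iIndepFun z P) (hw0 : Measurable w0)
    (hw0indep : IndepFun w0 (fun ω k => z k ω) P) {N B : ℕ} (hNB : N ∣ B) :
    IsInnovation P (Measure.pi fun _ : Fin N × Fin (B / N) => D)
      (fun t => history w0 z (t * B)) (batch N B z) where
  mono := fun s t h => history_mono (Nat.mul_le_mul_right _ h)
  le := fun t => history_le hz hw0 _
  measurable := fun t => by
    let _ := history w0 z ((t + 1) * B)
    refine measurable_pi_iff.2 fun i => measurable_history_sample ?_
    have := splitIndex_lt hNB i
    rw [add_mul, one_mul]; omega
  law := fun t => by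
    have h := hzindep.precomp (splitIndex_injective N B t)
    have h2 := (iIndepFun_iff_map_fun_eq_pi_map (fun i => (hz _).aemeasurable)).1 h
    simp only [hzlaw] at h2
    exact h2
  indep := fun t => by
    -- The past uses sample indices in `S`, the current round those in `T`; the initialization is
    -- independent of both blocks jointly.
    set S := Finset.range (t * B)
    set T := Finset.Ico (t * B) ((t + 1) * B)
    have hST : Disjoint S T := by
      rw [Finset.disjoint_left]
      intro a ha hb
      simp only [S, T, Finset.mem_range, Finset.mem_Ico] at ha hb
      omega
    have h1 : IndepFun (fun ω (k : S) => z k ω) (fun ω (k : T) => z k ω) P :=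
      hzindep.indepFun_finset S T hST hz
    have h2 : IndepFun w0 (fun ω => ((fun k : S => z k ω), (fun k : T => z k ω))) P :=
      hw0indep.comp (ψ := fun x : ℕ → Vec d => ((fun k : S => x k), (fun k : T => x k)))
        measurable_id (by fun_prop)
    have hmS : Measurable fun ω (k : S) => z k ω := measurable_pi_iff.2 fun k => hz k
    have hmT : Measurable fun ω (k : T) => z k ω := measurable_pi_iff.2 fun k => hz k
    have h3 := indepFun_prodMk_left hw0 hmS hmT h2 h1
    have hmem : ∀ i : Fin N × Fin (B / N), (i.2 : ℕ) + i.1 * (B / N) + t * B ∈ T := by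
      intro i
      have := splitIndex_lt hNB i
      simp only [T, Finset.mem_Ico, add_mul, one_mul]
      omega
    have h4 := h3.comp (φ := id) measurable_id
      (ψ := fun (x : T → Vec d) (i : Fin N × Fin (B / N)) => x ⟨_, hmem i⟩) (by fun_prop)
    rw [IndepFun_iff_Indep] at h4
    exact h4

end Stream

end DMKrasulina

/-! ### One-step drift of the squared sine. -/

namespace DMKrasulina

variable {d : ℕ}

/-- The squared sine of the angle between `w` and the unit vector `e`. -/
noncomputable def sinSq (e w : Vec d) : ℝ := 1 - (inner ℝ e w) ^ 2 / ‖w‖ ^ 2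

theorem inner_sq_le_norm_sq {e : Vec d} (he : ‖e‖ = 1) (w : Vec d) :
    (inner ℝ e w) ^ 2 ≤ ‖w‖ ^ 2 := by
  have := abs_real_inner_le_norm e w
  rw [he, one_mul] at this
  rw [← sq_abs]
  exact pow_le_pow_left₀ (abs_nonneg _) this 2

theorem sinSq_nonneg {e : Vec d} (he : ‖e‖ = 1) (w : Vec d) : 0 ≤ sinSq e w :=
  sub_nonneg.2 (div_le_one_of_le₀ (inner_sq_le_norm_sq he w) (sq_nonneg _))

theorem sinSq_le_one (e w : Vec d) : sinSq e w ≤ 1 :=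
  sub_le_self _ (by positivity)

theorem measurable_sinSq (e : Vec d) : Measurable (sinSq e) := by
  unfold sinSq; fun_prop

theorem norm_add_smul_sq {w ξ : Vec d} (h : inner ℝ w ξ = 0) (η : ℝ) :
    ‖w + η • ξ‖ ^ 2 = ‖w‖ ^ 2 + η ^ 2 * ‖ξ‖ ^ 2 := by
  rw [norm_add_sq_real, inner_smul_right, h, norm_smul, mul_pow, Real.norm_eq_abs, sq_abs]
  ring

theorem sinSq_add_smul_le {e w ξ : Vec d} (he : ‖e‖ = 1) (hw : w ≠ 0) (h : inner ℝ w ξ = 0)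
    (η : ℝ) : sinSq e (w + η • ξ) ≤ sinSq e w -
      2 * η * inner ℝ e w / ‖w‖ ^ 2 * inner ℝ e ξ + η ^ 2 / ‖w‖ ^ 2 * ‖ξ‖ ^ 2 := by
  have hn : 0 < ‖w‖ ^ 2 := by positivity
  have h1 := inner_sq_le_norm_sq he (w + η • ξ)
  rw [norm_add_smul_sq h] at h1
  have h2 : inner ℝ e (w + η • ξ) = inner ℝ e w + η * inner ℝ e ξ := by
    rw [inner_add_right, inner_smul_right]
  rw [sinSq, norm_add_smul_sq h, sinSq]
  rw [h2] at h1 ⊢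
  set p := inner ℝ e w
  set q := inner ℝ e ξ
  set n := ‖w‖ ^ 2
  set y := η ^ 2 * ‖ξ‖ ^ 2 with hy
  have hy0 : 0 ≤ y := by positivity
  -- After clearing denominators this is `y ((p + η q)² - n - y) ≤ 0`, which is Cauchy–Schwarz `h1`
  -- for the new iterate. It replaces the random denominator by the old one.
  have h3 : ((p + η * q) ^ 2 - y) / n ≤ (p + η * q) ^ 2 / (n + y) := by
    rw [div_le_div_iff₀ hn (by positivity)]
    nlinarith
  have h4 : p ^ 2 / n + 2 * η * p / n * q - η ^ 2 / n * ‖ξ‖ ^ 2 ≤ ((p + η * q) ^ 2 - y) / n := by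
    have : p ^ 2 / n + 2 * η * p / n * q - η ^ 2 / n * ‖ξ‖ ^ 2 = (p ^ 2 + 2 * η * p * q - y) / n := by
      rw [hy]; field_simp
    rw [this]
    gcongr
    nlinarith [sq_nonneg (η * q)]
  linarith

/-- The iterates of Krasulina's method, driven by independent batches `Y` with entries of law `D`,
started on the unit sphere. -/
structure IsKrasulina {Ω : Type*} [MeasurableSpace Ω] {ι : Type*} [Fintype ι] (P : Measure Ω)
    (D : Measure (Vec d)) (ℱ : ℕ → MeasurableSpace Ω) (Y : ℕ → Ω → ι → Vec d) (η : ℕ → ℝ)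
    (w : ℕ → Ω → Vec d) : Prop where
  innovation : IsInnovation P (Measure.pi fun _ : ι => D) ℱ Y
  measurable : ∀ t, Measurable[ℱ t] (w t)
  succ : ∀ t ω, w (t + 1) ω = w t ω + η (t + 1) • batchDir (w t ω) (Y t ω)
  norm_init : ∀ᵐ ω ∂P, ‖w 0 ω‖ = 1

namespace IsKrasulina

variable {Ω : Type*} [mΩ : MeasurableSpace Ω] {ι : Type*} [Fintype ι] {P : Measure Ω}
  {D : Measure (Vec d)} {ℱ : ℕ → MeasurableSpace Ω} {Y : ℕ → Ω → ι → Vec d} {η : ℕ → ℝ}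
  {w : ℕ → Ω → Vec d} {κ : ℝ} {e : Vec d} {lam g : ℝ}

theorem measurable' (h : IsKrasulina P D ℱ Y η w) (t : ℕ) : Measurable (w t) :=
  (h.measurable t).mono (h.innovation.le t) le_rfl

theorem norm_succ_sq (h : IsKrasulina P D ℱ Y η w) (t : ℕ) (ω : Ω) :
    ‖w (t + 1) ω‖ ^ 2 = ‖w t ω‖ ^ 2 + η (t + 1) ^ 2 * ‖batchDir (w t ω) (Y t ω)‖ ^ 2 := by
  rw [h.succ, norm_add_smul_sq (inner_batchDir_self _ _)]

theorem norm_sq_mono (h : IsKrasulina P D ℱ Y η w) (ω : Ω) :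
    Monotone fun t => ‖w t ω‖ ^ 2 :=
  monotone_nat_of_le_succ fun t => by
    rw [h.norm_succ_sq]
    exact le_add_of_nonneg_right (by positivity)

theorem ae_bound [IsProbabilityMeasure D] (h : IsKrasulina P D ℱ Y η w) (hκ : ∀ᵐ x ∂D, ‖x‖ ≤ κ) :
    ∀ᵐ ω ∂P, ∀ t i, ‖Y t ω i‖ ≤ κ := by
  rw [ae_all_iff]
  intro t
  have h1 := ae_pi_norm_le (ι := ι) hκ
  rw [← h.innovation.law t] at h1
  exact ae_of_ae_map (h.innovation.measurable' t).aemeasurable h1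

theorem ne_zero (h : IsKrasulina P D ℱ Y η w) {ω : Ω} (h0 : ‖w 0 ω‖ = 1) (t : ℕ) :
    w t ω ≠ 0 := by
  have := h.norm_sq_mono ω (Nat.zero_le t)
  simp only [h0] at this
  intro hc
  rw [hc] at this
  norm_num at this

/-- A step multiplies `‖w‖²` by at most `1 + η² κ⁴`. For steps `c / (Q + t)` the exponent is at most
`c² κ⁴ / Q`, so from a unit start the norms stay in a thin shell. -/
theorem norm_sq_le_exp [Nonempty ι] (h : IsKrasulina P D ℱ Y η w) {ω : Ω} (hω : ∀ t i, ‖Y t ω i‖ ≤ κ)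
    {s t : ℕ} (hst : s ≤ t) :
    ‖w t ω‖ ^ 2 ≤ Real.exp (∑ r ∈ Finset.Ico s t, η (r + 1) ^ 2 * κ ^ 4) * ‖w s ω‖ ^ 2 := by
  induction t, hst using Nat.le_induction with
  | base => simp
  | succ t hst ih =>
    rw [Finset.sum_Ico_succ_top hst, Real.exp_add, h.norm_succ_sq]
    have h1 := norm_batchDir_le (w t ω) (Y t ω) (hω t)
    have h2 : ‖batchDir (w t ω) (Y t ω)‖ ^ 2 ≤ κ ^ 4 * ‖w t ω‖ ^ 2 := by
      calc _ ≤ (κ ^ 2 * ‖w t ω‖) ^ 2 := pow_le_pow_left₀ (norm_nonneg _) h1 2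
        _ = _ := by ring
    have h3 := Real.add_one_le_exp (η (t + 1) ^ 2 * κ ^ 4)
    calc ‖w t ω‖ ^ 2 + η (t + 1) ^ 2 * ‖batchDir (w t ω) (Y t ω)‖ ^ 2
        ≤ ‖w t ω‖ ^ 2 + η (t + 1) ^ 2 * (κ ^ 4 * ‖w t ω‖ ^ 2) := by gcongr
      _ = (η (t + 1) ^ 2 * κ ^ 4 + 1) * ‖w t ω‖ ^ 2 := by ring
      _ ≤ Real.exp (η (t + 1) ^ 2 * κ ^ 4) * ‖w t ω‖ ^ 2 := by gcongr
      _ ≤ Real.exp (η (t + 1) ^ 2 * κ ^ 4) *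
          (Real.exp (∑ r ∈ Finset.Ico s t, η (r + 1) ^ 2 * κ ^ 4) * ‖w s ω‖ ^ 2) := by gcongr
      _ = _ := by ring

theorem integrable_sinSq [IsFiniteMeasure P] (h : IsKrasulina P D ℱ Y η w) (he : ‖e‖ = 1)
    (t : ℕ) : Integrable (fun ω => sinSq e (w t ω)) P :=
  Integrable.of_bound ((measurable_sinSq e).comp (h.measurable' t)).aestronglyMeasurable 1
    (.of_forall fun ω => by
      rw [Real.norm_of_nonneg (sinSq_nonneg he _)]; exact sinSq_le_one e _)

theorem integrable_sinSq_step [IsFiniteMeasure P] (h : IsKrasulina P D ℱ Y η w) (he : ‖e‖ = 1)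
    (t : ℕ) : Integrable (fun ω => sinSq e (w t ω) -
        2 * η (t + 1) * g * sinSq e (w t ω) * (1 - sinSq e (w t ω)) +
        η (t + 1) ^ 2 * (lam ^ 2 * sinSq e (w t ω) + covNoise D ι)) P := by
  have hInt := h.integrable_sinSq he t
  have h1 : Integrable (fun ω => (2 * η (t + 1) * g * sinSq e (w t ω)) *
      (1 - sinSq e (w t ω))) P := by
    refine (hInt.const_mul _).mul_of_top_left (MemLp.sub (memLp_const 1) ?_)
    exact MemLp.of_bound hInt.aestronglyMeasurable 1 (.of_forall fun ω => by
      rw [Real.norm_of_nonneg (sinSq_nonneg he _)]; exact sinSq_le_one e _)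
  exact (hInt.sub h1).add (((hInt.const_mul _).add (integrable_const _)).const_mul _)

variable [Nonempty ι] [IsProbabilityMeasure P] [IsProbabilityMeasure D]

/-- The expected squared sine after one step from `w`. -/
theorem integral_sinSq_step_le (hκ : ∀ᵐ x ∂D, ‖x‖ ≤ κ)
    (he : IsTopEigenvector (covOp D) e lam g) {v : Vec d} (hv : v ≠ 0) {a : ℝ} (ha : 0 ≤ a) :
    ∫ y, sinSq e (v + a • batchDir v y) ∂(Measure.pi fun _ : ι => D) ≤
      sinSq e v - 2 * a * g * sinSq e v * (1 - sinSq e v) +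
        a ^ 2 * (lam ^ 2 * sinSq e v + covNoise D ι) := by
  have hn : 0 < ‖v‖ ^ 2 := by positivity
  have hi1 : Integrable (fun y : ι → Vec d => sinSq e v -
      2 * a * inner ℝ e v / ‖v‖ ^ 2 * inner ℝ e (batchDir v y)) (Measure.pi fun _ : ι => D) :=
    (integrable_const _).sub ((integrable_inner_batchDir hκ e v).const_mul _)
  have hi2 : Integrable (fun y : ι → Vec d => a ^ 2 / ‖v‖ ^ 2 * ‖batchDir v y‖ ^ 2)
      (Measure.pi fun _ : ι => D) := (integrable_norm_batchDir_sq hκ v).const_mul _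
  have h1 := integral_mono_of_nonneg (μ := Measure.pi fun _ : ι => D)
    (f := fun y => sinSq e (v + a • batchDir v y)) (.of_forall fun y => sinSq_nonneg he.norm_eq _)
    (hi1.add hi2) (.of_forall fun y =>
      sinSq_add_smul_le he.norm_eq hv (inner_batchDir_self v y) a)
  refine h1.trans ?_
  simp only [Pi.add_apply]
  rw [integral_add hi1 hi2, integral_sub (integrable_const _)
    ((integrable_inner_batchDir hκ e v).const_mul _), integral_const_mul, integral_const_mul,
    integral_inner_batchDir hκ, inner_meanDir he]
  simp only [integral_const, probReal_univ, one_smul]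
  have h2 := integral_norm_batchDir_sq_le (ι := ι) hκ v
  have h3 := norm_meanDir_sq_le he v
  have h4 := he.gap_mul_le v
  have hs : ‖v‖ ^ 2 - (inner ℝ e v) ^ 2 = sinSq e v * ‖v‖ ^ 2 := by
    rw [sinSq]; field_simp
  have hp : (inner ℝ e v) ^ 2 = (1 - sinSq e v) * ‖v‖ ^ 2 := by
    rw [sinSq]; field_simp; ring
  rw [hs] at h3 h4
  -- The eigengap enters here: it turns the first-order term into `-2 a g s (1 - s)`.
  have h5 : g * sinSq e v ≤ lam - inner ℝ v (covOp D v) / ‖v‖ ^ 2 := by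
    rw [le_sub_iff_add_le, ← le_sub_iff_add_le', div_le_iff₀ hn]
    nlinarith
  have h6 : a ^ 2 / ‖v‖ ^ 2 * ∫ y, ‖batchDir v y‖ ^ 2 ∂(Measure.pi fun _ : ι => D) ≤
      a ^ 2 * (lam ^ 2 * sinSq e v + covNoise D ι) := by
    calc _ ≤ a ^ 2 / ‖v‖ ^ 2 * ((lam ^ 2 * sinSq e v + covNoise D ι) * ‖v‖ ^ 2) := by
          gcongr; linarith
      _ = _ := by field_simp
  have h7 : 2 * a * inner ℝ e v / ‖v‖ ^ 2 *
      (inner ℝ e v * (lam - inner ℝ v (covOp D v) / ‖v‖ ^ 2)) =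
      2 * a * (1 - sinSq e v) * (lam - inner ℝ v (covOp D v) / ‖v‖ ^ 2) := by
    calc _ = 2 * a * (inner ℝ e v) ^ 2 / ‖v‖ ^ 2 *
          (lam - inner ℝ v (covOp D v) / ‖v‖ ^ 2) := by ring
      _ = _ := by rw [hp]; field_simp
  have h8 : 0 ≤ 1 - sinSq e v := by linarith [sinSq_le_one e v]
  have h9 : 2 * a * (1 - sinSq e v) * (g * sinSq e v) ≤
      2 * a * (1 - sinSq e v) * (lam - inner ℝ v (covOp D v) / ‖v‖ ^ 2) := by gcongr
  rw [h7]
  nlinarith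

theorem setIntegral_sinSq_succ_le (h : IsKrasulina P D ℱ Y η w) (hκ : ∀ᵐ x ∂D, ‖x‖ ≤ κ)
    (he : IsTopEigenvector (covOp D) e lam g) {t : ℕ} (hη : 0 ≤ η (t + 1)) {A : Set Ω}
    (hA : MeasurableSet[ℱ t] A) :
    ∫ ω in A, sinSq e (w (t + 1) ω) ∂P ≤
      ∫ ω in A, (sinSq e (w t ω) -
        2 * η (t + 1) * g * sinSq e (w t ω) * (1 - sinSq e (w t ω)) +
        η (t + 1) ^ 2 * (lam ^ 2 * sinSq e (w t ω) + covNoise D ι)) ∂P := by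
  have hA' : MeasurableSet A := h.innovation.le t _ hA
  -- `A` is decided by the past, so its indicator can be frozen together with the iterate; the
  -- integral over `A` becomes one over `Ω`.
  set X : Ω → Vec d × ℝ := fun ω => (w t ω, A.indicator (fun _ => (1 : ℝ)) ω)
  have hX : Measurable[ℱ t] X := by
    have h1 : Measurable[ℱ t] (A.indicator fun _ => (1 : ℝ)) :=
      (measurable_const (a := (1 : ℝ))).indicator hA
    exact (h.measurable t).prodMk h1
  set φ : (Vec d × ℝ) × (ι → Vec d) → ℝ := fun p =>
    p.1.2 * sinSq e (p.1.1 + η (t + 1) • batchDir p.1.1 p.2)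
  have hφ : Measurable φ := by
    have h1 : Measurable fun p : (Vec d × ℝ) × (ι → Vec d) => batchDir p.1.1 p.2 :=
      measurable_batchDir (by fun_prop) (by fun_prop)
    have h2 := measurable_sinSq e
    fun_prop
  have hφX : ∀ ω, φ (X ω, Y t ω) = A.indicator (fun ω => sinSq e (w (t + 1) ω)) ω := by
    intro ω
    by_cases hω : ω ∈ A <;> simp [φ, X, hω, h.succ]
  have hInt := h.integrable_sinSq he.norm_eq
  have hInt1 : Integrable (fun ω => φ (X ω, Y t ω)) P := by
    simp only [hφX]
    exact (hInt (t + 1)).indicator hA'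
  have hInt2 := h.integrable_sinSq_step (lam := lam) (g := g) he.norm_eq t
  have hl : ∫ ω in A, sinSq e (w (t + 1) ω) ∂P = ∫ ω, φ (X ω, Y t ω) ∂P := by
    simp only [hφX]
    rw [integral_indicator hA']
  rw [hl, h.innovation.integral_eq hX hφ hInt1, ← integral_indicator hA']
  refine integral_mono_ae (h.innovation.integrable_integral hX hφ hInt1)
    (hInt2.indicator hA') ?_
  filter_upwards [h.norm_init] with ω hω
  by_cases hωA : ω ∈ A
  · simp only [φ, X, hωA, Set.indicator_of_mem, one_mul]
    exact integral_sinSq_step_le hκ he (h.ne_zero hω t) hη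
  · simp [φ, X, hωA]

end IsKrasulina

section Truncation

variable {Ω : Type*} [MeasurableSpace Ω] {P : Measure Ω} [IsProbabilityMeasure P]

/-- Discarding the part of an event where `f` is large lowers the conditional mean of `f`. -/
theorem setIntegral_inter_le_mul {f : Ω → ℝ} (hf : Integrable f P) (hfm : Measurable f)
    {A : Set Ω} (hA : MeasurableSet A) (θ : ℝ) :
    (∫ ω in A ∩ {ω | f ω ≤ θ}, f ω ∂P) * P.real A ≤
      (∫ ω in A, f ω ∂P) * P.real (A ∩ {ω | f ω ≤ θ}) := by
  have hm : MeasurableSet {ω | f ω ≤ θ} := measurableSet_le hfm measurable_const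
  set G := {ω | f ω ≤ θ}
  have h1 : ∫ ω in A ∩ G, f ω ∂P + ∫ ω in A \ G, f ω ∂P = ∫ ω in A, f ω ∂P :=
    integral_inter_add_sdiff hm hf.integrableOn
  have h2 : P.real (A ∩ G) + P.real (A \ G) = P.real A := measureReal_inter_add_sdiff hm
  -- `θ` separates the means of `f` over `A ∩ G` and `A \ G`; the cross-multiplied form also covers
  -- null sets.
  have h3 : ∫ ω in A ∩ G, f ω ∂P ≤ θ * P.real (A ∩ G) := by
    have := setIntegral_mono_on (μ := P) (s := A ∩ G) hf.integrableOn
      (integrable_const θ).integrableOn (hA.inter hm) (fun ω hω => hω.2)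
    simpa [mul_comm] using this
  have h4 : θ * P.real (A \ G) ≤ ∫ ω in A \ G, f ω ∂P := by
    have := setIntegral_mono_on (μ := P) (s := A \ G) (integrable_const θ).integrableOn
      hf.integrableOn (hA.diff hm) (fun ω hω => (not_le.1 hω.2).le)
    simpa [mul_comm] using this
  rw [← h1, ← h2]
  have h5 : 0 ≤ P.real (A ∩ G) := measureReal_nonneg
  have h6 : 0 ≤ P.real (A \ G) := measureReal_nonneg
  nlinarith [mul_le_mul_of_nonneg_right h3 h6, mul_le_mul_of_nonneg_right h4 h5]

end Truncation

end DMKrasulina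

/-! ### Alignment after a burn-in, and contraction on the aligned events. -/

namespace DMKrasulina

variable {d : ℕ}

section Pathwise

/-- A perturbed growing sequence stays above `W 0 - r`, and its compensated version increases. -/
theorem compensated_monotone {W M h : ℕ → ℝ} {r : ℝ} (hW : ∀ t, W (t + 1) = W t * (1 + h t) +
    (M (t + 1) - M t)) (hM0 : M 0 = 0) (hM : ∀ t, |M t| ≤ r) (hh : ∀ t, 0 ≤ h t)
    (h0 : r ≤ W 0) : (Monotone fun t => W t - M t) ∧ ∀ t, 0 ≤ W t := by
  -- With `W 0 ≥ r ≥ |M t|` this forces `W t ≥ 0`, so the growth term cannot become negative and the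
  -- induction closes.
  have key : ∀ t, W 0 ≤ W t - M t := by
    intro t
    induction t with
    | zero => simp [hM0]
    | succ t ih =>
      have h1 := (abs_le.1 (hM t)).1
      have h2 : 0 ≤ W t * h t := mul_nonneg (by linarith) (hh t)
      rw [hW]; nlinarith
  have hpos : ∀ t, 0 ≤ W t := fun t => by
    have h1 := (abs_le.1 (hM t)).1
    linarith [key t]
  refine ⟨monotone_nat_of_le_succ fun t => ?_, hpos⟩
  have h2 : 0 ≤ W t * h t := mul_nonneg (hpos t) (hh t)
  rw [hW]; nlinarith

/-- While the growth rate is at least `β`, the compensated sequence grows like the product of the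
`1 + β`. -/
theorem prod_le_compensated {W M h β : ℕ → ℝ} {r : ℝ} (hW : ∀ t, W (t + 1) = W t * (1 + h t) +
    (M (t + 1) - M t)) (hM0 : M 0 = 0) (hM : ∀ t, |M t| ≤ r) (hh : ∀ t, 0 ≤ h t)
    (h0 : r ≤ W 0) (hβ0 : ∀ t, 0 ≤ β t) {T : ℕ} (hβ : ∀ t < T, β t ≤ h t) :
    (W 0 - r) * ∏ s ∈ Finset.range T, (1 + β s) ≤ W T := by
  obtain ⟨-, hpos⟩ := compensated_monotone hW hM0 hM hh h0
  -- The invariant subtracts both the noise and its bound: the result is at most `W t`, so the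
  -- growth of `W` dominates the growth required of it.
  have key : ∀ t ≤ T, (W 0 - r) * ∏ s ∈ Finset.range t, (1 + β s) ≤ W t - M t - r := by
    intro t
    induction t with
    | zero => intro; simp [hM0]
    | succ t ih =>
      intro ht
      have h1 := ih (by omega)
      have h2 := (abs_le.1 (hM t)).1
      rw [Finset.prod_range_succ, ← mul_assoc]
      have h3 : W t * β t ≤ W t * h t := mul_le_mul_of_nonneg_left (hβ t (by omega)) (hpos t)
      have h4 : (W t - M t - r) * β t ≤ W t * β t :=
        mul_le_mul_of_nonneg_right (by linarith) (hβ0 t)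
      have h5 := mul_le_mul_of_nonneg_right h1 (show (0 : ℝ) ≤ 1 + β t by linarith [hβ0 t])
      rw [hW]; nlinarith
  have h1 := key T le_rfl
  have h2 := (abs_le.1 (hM T)).1
  linarith

/-- Once the normalized sequence `W / n` has had time to grow, its square exceeds `2 / 3` for
ever. -/
theorem two_thirds_le_of_growth {W M h β n : ℕ → ℝ} {r R : ℝ}
    (hW : ∀ t, W (t + 1) = W t * (1 + h t) + (M (t + 1) - M t)) (hM0 : M 0 = 0)
    (hM : ∀ t, |M t| ≤ r) (hh : ∀ t, 0 ≤ h t) (h0 : r ≤ W 0) (hβ0 : ∀ t, 0 ≤ β t)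
    (hβ : ∀ t, W t ^ 2 < 3 / 4 * n t ^ 2 → β t ≤ h t) (hn1 : ∀ t, 1 ≤ n t)
    (hnR : ∀ s t, s ≤ t → n t ^ 2 ≤ R * n s ^ 2) (hn0 : n 0 = 1) (hR : R ≤ 101 / 100)
    (hr : r ≤ 1 / 50) {T : ℕ} (hT : 1 ≤ (W 0 - r) * ∏ s ∈ Finset.range T, (1 + β s))
    {t : ℕ} (ht : T ≤ t) : 2 / 3 * n t ^ 2 ≤ W t ^ 2 := by
  obtain ⟨hmono, hpos⟩ := compensated_monotone hW hM0 hM hh h0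
  -- Without such a time, growth gives `W T ≥ 1`, whereas `W T ^ 2 < 3/4 * 101/100 < 1`.
  obtain ⟨s, hs, hs2⟩ : ∃ s ≤ T, 3 / 4 * n s ^ 2 ≤ W s ^ 2 := by
    by_contra! hcon
    have h1 := hT.trans (prod_le_compensated hW hM0 hM hh h0 hβ0
      fun t ht => hβ t (hcon t ht.le))
    have h2 := hcon T le_rfl
    have h3 := hnR 0 T (Nat.zero_le _)
    rw [hn0] at h3
    nlinarith
  have h1 : W s - M s ≤ W t - M t := hmono (hs.trans ht)
  have h2 := (abs_le.1 (hM s)).2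
  have h3 := (abs_le.1 (hM t)).1
  -- The noise costs at most `2 r ≤ 1/25`, and `n s ≥ 1` makes this a relative loss. Both this and
  -- the 1% norm growth fit, since `√(3/4) - 1/25 > √(2/3 * 101/100)`.
  have h4 : W s - 1 / 25 ≤ W t := by linarith
  have h5 := hnR s t (hs.trans ht)
  have h6 := hn1 s
  have h7 : 43 / 50 * n s ≤ W s := by
    by_contra! hc
    nlinarith [hpos s]
  have h8 : 41 / 50 * n s ≤ W t := by linarith
  have h9 : (41 / 50 * n s) ^ 2 ≤ W t ^ 2 := pow_le_pow_left₀ (by linarith) h8 2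
  nlinarith [sq_nonneg (n s)]

end Pathwise

namespace IsKrasulina

section Aligned

variable {Ω : Type*} {w : ℕ → Ω → Vec d} {e : Vec d}

/-- The event that the iterates between times `T` and `t - 1` are aligned with `e`. -/
def aligned (e : Vec d) (w : ℕ → Ω → Vec d) (T t : ℕ) : Set Ω :=
  {ω | ∀ s, T ≤ s → s < t → sinSq e (w s ω) ≤ 1 / 3}

theorem aligned_antitone (T : ℕ) : Antitone (aligned e w T) :=
  fun _ _ hst _ hω r hr hrs => hω r hr (hrs.trans_le hst)

theorem aligned_succ {T t : ℕ} (hT : T ≤ t) :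
    aligned e w T (t + 1) = aligned e w T t ∩ {ω | sinSq e (w t ω) ≤ 1 / 3} := by
  ext ω
  simp only [aligned, Set.mem_inter_iff, Set.mem_ofPred_eq]
  constructor
  · exact fun hω => ⟨fun s hs hst => hω s hs (by omega), hω t hT (by omega)⟩
  · rintro ⟨h1, h2⟩ s hs hst
    rcases Nat.lt_succ_iff_lt_or_eq.1 hst with hlt | rfl
    · exact h1 s hs hlt
    · exact h2

end Aligned

variable {Ω : Type*} [mΩ : MeasurableSpace Ω] {ι : Type*} [Fintype ι] {P : Measure Ω}
  {D : Measure (Vec d)} {ℱ : ℕ → MeasurableSpace Ω} {Y : ℕ → Ω → ι → Vec d} {η : ℕ → ℝ}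
  {w : ℕ → Ω → Vec d} {κ : ℝ} {e : Vec d} {lam g : ℝ}

/-- The noise in direction `e` accumulated until it first exceeds `r`. -/
noncomputable def stoppedNoise (D : Measure (Vec d)) (e : Vec d) (η : ℕ → ℝ)
    (w : ℕ → Ω → Vec d) (Y : ℕ → Ω → ι → Vec d) (r : ℝ) : ℕ → Ω → ℝ
  | 0, _ => 0
  | t + 1, ω => stoppedNoise D e η w Y r t ω +
      if |stoppedNoise D e η w Y r t ω| ≤ r then
        η (t + 1) * inner ℝ e (batchDir (w t ω) (Y t ω) - meanDir D (w t ω)) else 0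

theorem measurable_noise_step {α : Type*} {_ : MeasurableSpace α} {m : α → ℝ} {v : α → Vec d}
    {y : α → ι → Vec d} (r a : ℝ) (hm : Measurable m) (hv : Measurable v) (hy : Measurable y) :
    Measurable fun x => m x + if |m x| ≤ r then
      a * inner ℝ e (batchDir (v x) (y x) - meanDir D (v x)) else 0 := by
  have h1 := measurable_batchDir hv hy
  have h2 := (measurable_meanDir D).comp hv
  have h3 : Measurable fun x => inner ℝ e (batchDir (v x) (y x) - meanDir D (v x)) :=
    measurable_const.inner (h1.sub h2)
  exact hm.add (Measurable.ite (measurableSet_le (by fun_prop) measurable_const)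
    (h3.const_mul _) measurable_const)

theorem measurable_stoppedNoise (h : IsKrasulina P D ℱ Y η w) (r : ℝ) (t : ℕ) :
    Measurable[ℱ t] (stoppedNoise D e η w Y r t) := by
  induction t with
  | zero => exact measurable_const
  | succ t ih =>
    have hle := h.innovation.mono (Nat.le_succ t)
    exact measurable_noise_step r _ (ih.mono hle le_rfl) ((h.measurable t).mono hle le_rfl)
      (h.innovation.measurable t)

/-- The strict bound `s < t` matters: the event for `t + 1` is known at time `t`, so the step to `w
(t + 1)` can be averaged over a fresh batch on it. At `t = 0` the event is everything, which agrees
with the truncated `t - 1`. -/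
theorem measurableSet_aligned (h : IsKrasulina P D ℱ Y η w) (e : Vec d) (T t : ℕ) :
    MeasurableSet[ℱ (t - 1)] (aligned e w T t) := by
  have : aligned e w T t = ⋂ s, ⋂ (_ : T ≤ s), ⋂ (_ : s < t), {ω | sinSq e (w s ω) ≤ 1 / 3} := by
    ext; simp [aligned]
  rw [this]
  refine MeasurableSet.iInter fun s => MeasurableSet.iInter fun _ => MeasurableSet.iInter
    fun hs => ?_
  have h1 : Measurable[ℱ (t - 1)] (w s) :=
    (h.measurable s).mono (h.innovation.mono (by omega)) le_rfl
  exact measurableSet_le ((measurable_sinSq e).comp h1) measurable_const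

variable [Nonempty ι]

theorem abs_noise_le (he : IsTopEigenvector (covOp D) e lam g) {v : Vec d} {y : ι → Vec d}
    (hy : ∀ i, ‖y i‖ ≤ κ) :
    |inner ℝ e (batchDir v y - meanDir D v)| ≤ (κ ^ 2 + |lam|) * ‖v‖ := by
  have h1 := abs_real_inner_le_norm e (batchDir v y - meanDir D v)
  rw [he.norm_eq, one_mul] at h1
  have h2 := norm_sub_le (batchDir v y) (meanDir D v)
  have h3 := norm_batchDir_le v y hy
  have h4 : ‖meanDir D v‖ ≤ |lam| * ‖v‖ := by
    refine le_of_sq_le_sq ?_ (by positivity)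
    refine (norm_meanDir_sq_le he v).trans ?_
    rw [mul_pow, sq_abs]
    gcongr
    linarith [sq_nonneg (inner ℝ e v)]
  linarith

variable [IsProbabilityMeasure P] [IsProbabilityMeasure D]

/-- A crude bound depending on `t`; it serves integrability only. -/
theorem ae_abs_stoppedNoise_le (h : IsKrasulina P D ℱ Y η w) (hκ : ∀ᵐ x ∂D, ‖x‖ ≤ κ)
    (he : IsTopEigenvector (covOp D) e lam g) (r : ℝ) (t : ℕ) :
    ∃ C, ∀ᵐ ω ∂P, |stoppedNoise D e η w Y r t ω| ≤ C := by
  induction t with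
  | zero => exact ⟨0, .of_forall fun ω => by simp [stoppedNoise]⟩
  | succ t ih =>
    obtain ⟨C, hC⟩ := ih
    refine ⟨C + |η (t + 1)| * ((κ ^ 2 + |lam|) *
      √(Real.exp (∑ r ∈ Finset.Ico 0 t, η (r + 1) ^ 2 * κ ^ 4))), ?_⟩
    filter_upwards [hC, h.ae_bound hκ, h.norm_init] with ω h1 h2 h3
    have h4 := h.norm_sq_le_exp h2 (Nat.zero_le t)
    rw [h3, one_pow, mul_one] at h4
    have h5 := Real.le_sqrt_of_sq_le h4
    have h6 := abs_noise_le he (v := w t ω) (h2 t)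
    rw [stoppedNoise]
    refine (abs_add_le _ _).trans (add_le_add h1 ?_)
    split_ifs
    · rw [abs_mul]
      gcongr
      exact h6.trans (by gcongr)
    · simp only [abs_zero]; positivity

theorem integrable_stoppedNoise_sq (h : IsKrasulina P D ℱ Y η w) (hκ : ∀ᵐ x ∂D, ‖x‖ ≤ κ)
    (he : IsTopEigenvector (covOp D) e lam g) (r : ℝ) (t : ℕ) :
    Integrable (fun ω => stoppedNoise D e η w Y r t ω ^ 2) P := by
  obtain ⟨C, hC⟩ := h.ae_abs_stoppedNoise_le hκ he r t
  refine integrable_of_ae_bound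
    (((h.measurable_stoppedNoise r t).mono (h.innovation.le t) le_rfl).pow_const 2) (C ^ 2) ?_
  filter_upwards [hC] with ω hω
  rw [abs_pow]
  exact pow_le_pow_left₀ (abs_nonneg _) hω 2

/-- The noise of a fresh batch has mean zero, so the cross term vanishes: this is orthogonality of
martingale increments, with past value `m`. -/
theorem integral_add_noise_sq_le (hκ : ∀ᵐ x ∂D, ‖x‖ ≤ κ)
    (he : IsTopEigenvector (covOp D) e lam g) (v : Vec d) (m a : ℝ) :
    ∫ y, (m + a * inner ℝ e (batchDir v y - meanDir D v)) ^ 2 ∂(Measure.pi fun _ : ι => D) ≤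
      m ^ 2 + a ^ 2 * (covNoise D ι * ‖v‖ ^ 2) := by
  set ν := Measure.pi fun _ : ι => D
  have hi0 : Integrable (fun y : ι → Vec d => inner ℝ e (batchDir v y - meanDir D v)) ν := by
    simp only [inner_sub_right]
    exact (integrable_inner_batchDir hκ e v).sub (integrable_const _)
  have hz : ∫ y : ι → Vec d, inner ℝ e (batchDir v y - meanDir D v) ∂ν = 0 := by
    simp only [inner_sub_right]
    rw [integral_sub (integrable_inner_batchDir hκ e v) (integrable_const _),
      integral_inner_batchDir hκ]
    simp
  have hi2 : Integrable (fun y : ι → Vec d => (inner ℝ e (batchDir v y - meanDir D v)) ^ 2) ν := by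
    refine integrable_of_ae_bound ?_ (((κ ^ 2 + |lam|) * ‖v‖) ^ 2) ?_
    · have hm := measurable_batchDir (ι := ι) (measurable_const (a := v)) measurable_id
      exact (measurable_const.inner (hm.sub_const _)).pow_const 2
    · filter_upwards [ae_pi_norm_le hκ] with y hy
      rw [abs_pow]
      exact pow_le_pow_left₀ (abs_nonneg _) (abs_noise_le he hy) 2
  have hexp : ∀ y : ι → Vec d, (m + a * inner ℝ e (batchDir v y - meanDir D v)) ^ 2 =
      m ^ 2 + (2 * m * a) * inner ℝ e (batchDir v y - meanDir D v) +
        a ^ 2 * (inner ℝ e (batchDir v y - meanDir D v)) ^ 2 := fun y => by ring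
  simp only [hexp]
  have hi1 : Integrable (fun y : ι → Vec d => m ^ 2 + (2 * m * a) *
      inner ℝ e (batchDir v y - meanDir D v)) ν := (integrable_const _).add (hi0.const_mul _)
  rw [integral_add hi1 (hi2.const_mul _), integral_add (integrable_const _) (hi0.const_mul _),
    integral_const_mul, integral_const_mul, hz]
  have := integral_inner_batchDir_sub_sq_le (ι := ι) hκ he.norm_eq v
  simp only [integral_const, probReal_univ, one_smul, mul_zero, add_zero]
  gcongr

theorem integral_stoppedNoise_sq_le (h : IsKrasulina P D ℱ Y η w) (hκ : ∀ᵐ x ∂D, ‖x‖ ≤ κ)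
    (he : IsTopEigenvector (covOp D) e lam g) (r : ℝ) {R : ℝ}
    (hR : ∀ᵐ ω ∂P, ∀ t, ‖w t ω‖ ^ 2 ≤ R) (t : ℕ) :
    ∫ ω, stoppedNoise D e η w Y r t ω ^ 2 ∂P ≤
      ∑ s ∈ Finset.range t, η (s + 1) ^ 2 * (covNoise D ι * R) := by
  have hInt := h.integrable_stoppedNoise_sq hκ he r
  induction t with
  | zero => simp [stoppedNoise]
  | succ t ih =>
    rw [Finset.sum_range_succ]
    set X : Ω → Vec d × ℝ := fun ω => (w t ω, stoppedNoise D e η w Y r t ω)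
    have hX : Measurable[ℱ t] X := (h.measurable t).prodMk (h.measurable_stoppedNoise r t)
    set φ : (Vec d × ℝ) × (ι → Vec d) → ℝ := fun p =>
      (p.1.2 + if |p.1.2| ≤ r then
        η (t + 1) * inner ℝ e (batchDir p.1.1 p.2 - meanDir D p.1.1) else 0) ^ 2
    have hφ : Measurable φ := by
      exact (measurable_noise_step r _ (by fun_prop) (by fun_prop) (by fun_prop)).pow_const 2
    have hφX : ∀ ω, φ (X ω, Y t ω) = stoppedNoise D e η w Y r (t + 1) ω ^ 2 := fun ω => rfl
    have hInt1 : Integrable (fun ω => φ (X ω, Y t ω)) P := by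
      simp only [hφX]; exact hInt (t + 1)
    have hv := covNoise_nonneg D ι
    calc ∫ ω, stoppedNoise D e η w Y r (t + 1) ω ^ 2 ∂P
        = ∫ ω, φ (X ω, Y t ω) ∂P := by simp only [hφX]
      _ = ∫ ω, ∫ y, φ (X ω, y) ∂(Measure.pi fun _ : ι => D) ∂P :=
        h.innovation.integral_eq hX hφ hInt1
      _ ≤ ∫ ω, (stoppedNoise D e η w Y r t ω ^ 2 + η (t + 1) ^ 2 * (covNoise D ι * R)) ∂P := by
        refine integral_mono_ae (h.innovation.integrable_integral hX hφ hInt1)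
          ((hInt t).add (integrable_const _)) ?_
        filter_upwards [hR] with ω hω
        simp only [φ, X]
        have hωt := hω t
        split_ifs
        · refine (integral_add_noise_sq_le hκ he _ _ _).trans ?_
          gcongr
        · have hR0 : 0 ≤ R := (sq_nonneg _).trans hωt
          simp only [add_zero, integral_const, probReal_univ, one_smul]
          exact le_add_of_nonneg_right (by positivity)
      _ = ∫ ω, stoppedNoise D e η w Y r t ω ^ 2 ∂P + η (t + 1) ^ 2 * (covNoise D ι * R) := by
        rw [integral_add (hInt t) (integrable_const _)]; simp
      _ ≤ _ := by gcongr

/-- Kolmogorov's inequality for the accumulated noise. -/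
theorem measure_stoppedNoise_gt_le (h : IsKrasulina P D ℱ Y η w) (hκ : ∀ᵐ x ∂D, ‖x‖ ≤ κ)
    (he : IsTopEigenvector (covOp D) e lam g) {r : ℝ} (hr : 0 < r) {R K : ℝ}
    (hR : ∀ᵐ ω ∂P, ∀ t, ‖w t ω‖ ^ 2 ≤ R)
    (hK : ∀ t, ∑ s ∈ Finset.range t, η (s + 1) ^ 2 * (covNoise D ι * R) ≤ K) :
    P {ω | ∃ t, r < |stoppedNoise D e η w Y r t ω|} ≤ ENNReal.ofReal (K / r ^ 2) := by
  have hset : {ω | ∃ t, r < |stoppedNoise D e η w Y r t ω|} =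
      ⋃ t, {ω | r < |stoppedNoise D e η w Y r t ω|} := by ext; simp
  -- Freezing the noise after its exit makes these events increase with `t`, so Chebyshev's
  -- inequality at fixed times bounds the probability of ever exceeding `r`.
  have hmono : Monotone fun t => {ω | r < |stoppedNoise D e η w Y r t ω|} := by
    refine monotone_nat_of_le_succ fun t ω hω => ?_
    simp only [Set.mem_ofPred_eq] at hω ⊢
    rw [stoppedNoise, if_neg (not_le.2 hω), add_zero]
    exact hω
  rw [hset, hmono.measure_iUnion]
  refine iSup_le fun t => ?_
  have h1 := mul_meas_ge_le_integral_of_nonneg (μ := P)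
    (f := fun ω => stoppedNoise D e η w Y r t ω ^ 2) (.of_forall fun ω => sq_nonneg _)
    (h.integrable_stoppedNoise_sq hκ he r t) (r ^ 2)
  have h2 := (h.integral_stoppedNoise_sq_le hκ he r hR t).trans (hK t)
  have h3 : P {ω | r < |stoppedNoise D e η w Y r t ω|} ≤
      P {ω | r ^ 2 ≤ stoppedNoise D e η w Y r t ω ^ 2} := by
    refine measure_mono fun ω hω => ?_
    simp only [Set.mem_ofPred_eq] at hω ⊢
    rw [← sq_abs (stoppedNoise D e η w Y r t ω)]
    exact pow_le_pow_left₀ hr.le hω.le 2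
  refine h3.trans ?_
  rw [← ofReal_measureReal]
  refine ENNReal.ofReal_le_ofReal ?_
  rw [le_div_iff₀ (by positivity)]
  linarith

/-- On the event that the noise stays small and the start is not nearly orthogonal to `e`, the
iterates are aligned with `e` from time `T` on. -/
theorem sinSq_le_third (h : IsKrasulina P D ℱ Y η w)
    (he : IsTopEigenvector (covOp D) e lam g) (hg : 0 ≤ g) (hη : ∀ t, 0 ≤ η t) {ω : Ω}
    (hY : ∀ t i, ‖Y t ω i‖ ≤ κ) (h0 : ‖w 0 ω‖ = 1) {S : ℝ}
    (hS : ∀ s t, ∑ r ∈ Finset.Ico s t, η (r + 1) ^ 2 * κ ^ 4 ≤ S) (hS' : Real.exp S ≤ 101 / 100)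
    {r : ℝ} (hr : r ≤ 1 / 50) (hM : ∀ t, |stoppedNoise D e η w Y r t ω| ≤ r)
    (hstart : r ≤ |inner ℝ e (w 0 ω)|) {T : ℕ}
    (hT : 1 ≤ (|inner ℝ e (w 0 ω)| - r) *
      ∏ s ∈ Finset.range T, (1 + η (s + 1) * g / 4)) {t : ℕ} (ht : T ≤ t) :
    sinSq e (w t ω) ≤ 1 / 3 := by
  -- `ς` is a sign for `⟨e, w 0⟩`; multiplying by it reduces both hemispheres to a nonnegative
  -- start.
  obtain ⟨ς, hς, habs⟩ : ∃ ς : ℝ, ς ^ 2 = 1 ∧ |inner ℝ e (w 0 ω)| = ς * inner ℝ e (w 0 ω) := by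
    rcases abs_cases (inner ℝ e (w 0 ω)) with hc | hc
    · exact ⟨1, by norm_num, by linarith [hc.1]⟩
    · exact ⟨-1, by norm_num, by linarith [hc.1]⟩
  have hςa : |ς| = 1 := by
    have := sq_abs ς
    rw [hς] at this
    nlinarith [abs_nonneg ς]
  have hnpos : ∀ t, 0 < ‖w t ω‖ := fun t => norm_pos_iff.2 (h.ne_zero h0 t)
  have hgap : ∀ t, g * sinSq e (w t ω) ≤
      lam - inner ℝ (w t ω) (covOp D (w t ω)) / ‖w t ω‖ ^ 2 := by
    intro t
    have hn0 := hnpos t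
    have hn : 0 < ‖w t ω‖ ^ 2 := by positivity
    have h4 := he.gap_mul_le (w t ω)
    have hs : ‖w t ω‖ ^ 2 - (inner ℝ e (w t ω)) ^ 2 = sinSq e (w t ω) * ‖w t ω‖ ^ 2 := by
      rw [sinSq]; field_simp
    rw [hs] at h4
    rw [le_sub_iff_add_le, ← le_sub_iff_add_le', div_le_iff₀ hn]
    nlinarith
  have hmain := two_thirds_le_of_growth
    (W := fun t => ς * inner ℝ e (w t ω)) (M := fun t => ς * stoppedNoise D e η w Y r t ω)
    (h := fun t => η (t + 1) * (lam - inner ℝ (w t ω) (covOp D (w t ω)) / ‖w t ω‖ ^ 2))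
    (β := fun t => η (t + 1) * g / 4) (n := fun t => ‖w t ω‖) (r := r) (R := Real.exp S)
    (T := T) (t := t) ?_ ?_ ?_ ?_ ?_ ?_ ?_ ?_ ?_ h0 hS' hr ?_ ht
  · have hn := hnpos t
    rw [mul_pow, hς, one_mul] at hmain
    rw [sinSq, sub_le_comm, le_div_iff₀ (by positivity)]
    linarith
  · intro t
    -- By `hM` the stopping never acts on this path, so the increment is the true noise and the
    -- recursion for `⟨e, w⟩` is exact.
    simp only [stoppedNoise, if_pos (hM t)]
    rw [h.succ, inner_add_right, inner_smul_right, inner_sub_right, inner_meanDir he]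
    ring
  · simp [stoppedNoise]
  · intro t; rw [abs_mul, hςa, one_mul]; exact hM t
  · intro t
    exact mul_nonneg (hη _) ((mul_nonneg hg (sinSq_nonneg he.norm_eq _)).trans (hgap t))
  · simpa only [← habs] using hstart
  · intro t
    have := hη (t + 1)
    positivity
  · intro t hlt
    simp only [mul_pow, hς, one_mul] at hlt
    rw [mul_div_assoc]
    refine mul_le_mul_of_nonneg_left (le_trans ?_ (hgap t)) (hη _)
    have hn := hnpos t
    -- `cos² < 3/4` means `sin² > 1/4`, hence the rate `η g / 4`.
    have h5 : 1 / 4 ≤ sinSq e (w t ω) := by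
      rw [sinSq, le_sub_comm, div_le_iff₀ (by positivity)]
      linarith
    nlinarith
  · intro t
    have h1 := h.norm_sq_mono ω (Nat.zero_le t)
    simp only [h0] at h1
    nlinarith [hnpos t]
  · intro s t hst
    refine (h.norm_sq_le_exp hY hst).trans ?_
    gcongr
    exact hS s t
  · simpa only [← habs] using hT

/-- The mean squared sine at time `t`, conditional on the alignment before time `t`. -/
noncomputable def condSinSq (P : Measure Ω) (e : Vec d) (w : ℕ → Ω → Vec d) (T t : ℕ) : ℝ :=
  (∫ ω in aligned e w T t, sinSq e (w t ω) ∂P) / P.real (aligned e w T t)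

theorem condSinSq_le_one (h : IsKrasulina P D ℱ Y η w) (he : ‖e‖ = 1) (T t : ℕ) :
    condSinSq P e w T t ≤ 1 := by
  refine div_le_one_of_le₀ ?_ measureReal_nonneg
  have := setIntegral_mono_on (μ := P) (s := aligned e w T t) (h.integrable_sinSq he t).integrableOn
    (integrable_const (1 : ℝ)).integrableOn
    (h.innovation.le _ _ (h.measurableSet_aligned e T t)) (fun ω _ => sinSq_le_one e _)
  simpa using this

/-- On the aligned event `1 - s ≥ 2/3`, so the quadratic drift `2 η g s (1 - s)` dominates the
linear `(4/3) η g s`. Replacing the event for `t` by that for `t + 1` is a truncation of `s` at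
`1/3` and can only lower the conditional mean. -/
theorem condSinSq_succ_le (h : IsKrasulina P D ℱ Y η w) (hκ : ∀ᵐ x ∂D, ‖x‖ ≤ κ)
    (he : IsTopEigenvector (covOp D) e lam g) (hg : 0 ≤ g) {T t : ℕ} (hT : T ≤ t)
    (hη : 0 ≤ η (t + 1)) (hpos : 0 < P.real (aligned e w T (t + 1)))
    (hcoef : 0 ≤ 1 - 4 / 3 * (η (t + 1) * g) + η (t + 1) ^ 2 * lam ^ 2) :
    condSinSq P e w T (t + 1) ≤
      (1 - 4 / 3 * (η (t + 1) * g) + η (t + 1) ^ 2 * lam ^ 2) * condSinSq P e w T t +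
        η (t + 1) ^ 2 * covNoise D ι := by
  have hm : MeasurableSet[ℱ t] (aligned e w T (t + 1)) := h.measurableSet_aligned e T (t + 1)
  have hm' := h.innovation.le _ _ hm
  have hmt := h.innovation.le _ _ (h.measurableSet_aligned e T t)
  have hpos' : 0 < P.real (aligned e w T t) :=
    hpos.trans_le (measureReal_mono (aligned_antitone T (Nat.le_succ t)))
  have hInt := h.integrable_sinSq he.norm_eq t
  set A := aligned e w T (t + 1)
  set k := 1 - 4 / 3 * (η (t + 1) * g) + η (t + 1) ^ 2 * lam ^ 2
  have h1 := h.setIntegral_sinSq_succ_le hκ he hη hm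
  have h2 : ∫ ω in A, sinSq e (w (t + 1) ω) ∂P ≤
      k * (∫ ω in A, sinSq e (w t ω) ∂P) + η (t + 1) ^ 2 * covNoise D ι * P.real A := by
    refine h1.trans ?_
    have h3 : ∫ ω in A, (k * sinSq e (w t ω) + η (t + 1) ^ 2 * covNoise D ι) ∂P =
        k * (∫ ω in A, sinSq e (w t ω) ∂P) + η (t + 1) ^ 2 * covNoise D ι * P.real A := by
      rw [integral_add (hInt.integrableOn.const_mul k) (integrable_const _).integrableOn,
        integral_const_mul]
      simp [mul_comm]
    rw [← h3]
    refine setIntegral_mono_on (h.integrable_sinSq_step he.norm_eq t).integrableOn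
      ((hInt.const_mul k).add (integrable_const _)).integrableOn hm' fun ω hω => ?_
    have h4 : sinSq e (w t ω) ≤ 1 / 3 := hω t hT (Nat.lt_succ_self t)
    have h5 := sinSq_nonneg he.norm_eq (w t ω)
    have h6 : 0 ≤ η (t + 1) * g := mul_nonneg hη hg
    simp only [k]
    nlinarith [mul_nonneg h6 (mul_nonneg h5 (show 0 ≤ 1 / 3 - sinSq e (w t ω) by linarith))]
  have h3 := setIntegral_inter_le_mul hInt ((measurable_sinSq e).comp (h.measurable' t)) hmt (1 / 3)
  rw [← aligned_succ hT] at h3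
  have h4 : (∫ ω in A, sinSq e (w t ω) ∂P) / P.real A ≤ condSinSq P e w T t := by
    rw [condSinSq, div_le_div_iff₀ hpos hpos']
    exact h3
  calc condSinSq P e w T (t + 1)
      ≤ (k * (∫ ω in A, sinSq e (w t ω) ∂P) + η (t + 1) ^ 2 * covNoise D ι * P.real A) /
          P.real A := by
        rw [condSinSq]; gcongr
    _ = k * ((∫ ω in A, sinSq e (w t ω) ∂P) / P.real A) + η (t + 1) ^ 2 * covNoise D ι := by
        field_simp
    _ ≤ _ := by gcongr

end IsKrasulina

end DMKrasulina

/-! ### Deterministic recursions and numerical comparisons. -/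

namespace DMKrasulina

section Recursion

theorem one_div_sq_le_sub {x : ℝ} (hx : 0 < x) :
    1 / (x + 1) ^ 2 ≤ 1 / x - 1 / (x + 1) := by
  rw [div_sub_div _ _ hx.ne' (by positivity), div_le_div_iff₀ (by positivity) (by positivity)]
  nlinarith

theorem sum_range_one_div_sq_le {q : ℝ} (hq : 0 < q) (t : ℕ) :
    ∑ s ∈ Finset.range t, 1 / (q + s + 1) ^ 2 ≤ 1 / q := by
  have key : ∑ s ∈ Finset.range t, 1 / (q + s + 1) ^ 2 ≤ 1 / q - 1 / (q + t) := by
    induction t with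
    | zero => simp
    | succ t ih =>
      rw [Finset.sum_range_succ]
      have h := one_div_sq_le_sub (x := q + t) (by positivity)
      push_cast
      rw [← add_assoc]
      linarith
  have : 0 ≤ 1 / (q + t) := by positivity
  linarith

theorem sum_Ico_one_div_sq_le {q : ℝ} (hq : 0 < q) (s t : ℕ) :
    ∑ r ∈ Finset.Ico s t, 1 / (q + r + 1) ^ 2 ≤ 1 / q := by
  refine le_trans ?_ (sum_range_one_div_sq_le hq t)
  refine Finset.sum_le_sum_of_subset_of_nonneg ?_ fun i _ _ => by positivity
  intro r hr
  simp only [Finset.mem_Ico, Finset.mem_range] at hr ⊢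
  exact hr.2

/-- The solution of the recursion satisfied by the conditional mean squared sine. -/
theorem le_of_contraction {m : ℕ → ℝ} {q α l n : ℝ} {T : ℕ} (hq : 0 < q) (hα : 1 < α)
    (hαq : α / q ≤ 1 / 2) (hl : 0 ≤ l) (hn : 0 ≤ n) (hm1 : ∀ t, m t ≤ 1)
    (hm : ∀ t, T ≤ t → m (t + 1) ≤
      (1 - α / (q + t + 1) + l / (q + t + 1) ^ 2) * m t + n / (q + t + 1) ^ 2) (t : ℕ) :
    m t ≤ Real.exp (2 * l / q) *
      (((q + T) / (q + t)) ^ α + n / ((α - 1) * (q + t))) := by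
  -- An integrating factor for the `l`-term: as `1 - α / (x + 1) ≥ 1/2`, adding `L` to it costs at
  -- most a factor `exp (2 L)`.
  set G : ℕ → ℝ := fun t => Real.exp (2 * l * ∑ s ∈ Finset.range t, 1 / (q + s + 1) ^ 2)
  have hG1 : ∀ t, 1 ≤ G t := fun t => Real.one_le_exp (by
    have : 0 ≤ ∑ s ∈ Finset.range t, 1 / (q + s + 1) ^ 2 :=
      Finset.sum_nonneg fun i _ => by positivity
    positivity)
  have hα1 : 0 < α - 1 := by linarith
  have hb0 : ∀ t : ℕ, 0 ≤ n / ((α - 1) * (q + t)) := fun t => by positivity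
  have key : m t ≤ G t * (((q + T) / (q + t)) ^ α + n / ((α - 1) * (q + t))) := by
    -- Up to time `T` the right-hand side is at least `1`, so `m ≤ 1` suffices.
    rcases le_or_gt t T with htT | htT
    · have h1 : 1 ≤ ((q + T) / (q + t)) ^ α := by
        refine Real.one_le_rpow ?_ (by linarith)
        rw [one_le_div (by positivity)]
        have : (t : ℝ) ≤ T := by exact_mod_cast htT
        linarith
      calc m t ≤ 1 * 1 := by simpa using hm1 t
        _ ≤ _ := mul_le_mul (hG1 t) (by linarith [hb0 t]) zero_le_one (by linarith [hG1 t])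
    · induction t, htT.le using Nat.le_induction with
      | base => exact absurd htT (lt_irrefl _)
      | succ t ht ih =>
        have ih' : m t ≤ G t * (((q + T) / (q + t)) ^ α + n / ((α - 1) * (q + t))) := by
          rcases ht.eq_or_lt with rfl | hlt
          · rw [div_self (by positivity), Real.one_rpow]
            calc m T ≤ 1 * 1 := by simpa using hm1 T
              _ ≤ _ := mul_le_mul (hG1 T) (by linarith [hb0 T]) zero_le_one
                (by linarith [hG1 T])
          · exact ih hlt
        set x : ℝ := q + t with hx
        have hx0 : 0 < x := by positivity
        have hqx : q ≤ x := by simp [hx]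
        have hαx : α / (x + 1) ≤ 1 / 2 := by
          refine le_trans ?_ hαq
          gcongr
          linarith
        have hc0 : 0 ≤ 1 - α / (x + 1) := by linarith
        have hlx : 0 ≤ l / (x + 1) ^ 2 := by positivity
        -- Bernoulli: `1 - α / (x + 1) ≤ (x / (x + 1)) ^ α`.
        have hX : (1 - α / (x + 1)) * ((q + T) / x) ^ α ≤ ((q + T) / (x + 1)) ^ α := by
          have h1 : (q + T) / (x + 1) = (x / (x + 1)) * ((q + T) / x) := by field_simp
          rw [h1, Real.mul_rpow (by positivity) (by positivity)]
          gcongr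
          have h2 := one_add_mul_self_le_rpow_one_add (s := -(1 / (x + 1))) (p := α) (by
            rw [neg_le_neg_iff, div_le_one (by positivity)]; linarith) hα.le
          have h3 : x / (x + 1) = 1 + -(1 / (x + 1)) := by field_simp; ring
          rw [h3]
          refine le_trans (le_of_eq ?_) h2
          ring
        -- `n / ((α - 1) x)` is a supersolution: the slack is `n / (x (x + 1))`, more than the
        -- forcing term.
        have hY : (1 - α / (x + 1)) * (n / ((α - 1) * x)) + n / (x + 1) ^ 2 ≤
            n / ((α - 1) * (x + 1)) := by
          have h1 : n / ((α - 1) * (x + 1)) - (1 - α / (x + 1)) * (n / ((α - 1) * x)) =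
              n * (1 / (x * (x + 1))) := by
            field_simp; ring
          have h2 : 1 / (x + 1) ^ 2 ≤ 1 / (x * (x + 1)) := by
            apply one_div_le_one_div_of_le (by positivity)
            nlinarith
          have h3 := mul_le_mul_of_nonneg_left h2 hn
          have h4 : n / (x + 1) ^ 2 = n * (1 / (x + 1) ^ 2) := by ring
          linarith
        have hGs : G (t + 1) = G t * Real.exp (2 * (l / (x + 1) ^ 2)) := by
          simp only [G]
          rw [Finset.sum_range_succ, mul_add, Real.exp_add]
          congr 2
          rw [hx]; ring
        have hcoef : 1 - α / (x + 1) + l / (x + 1) ^ 2 ≤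
            (1 - α / (x + 1)) * Real.exp (2 * (l / (x + 1) ^ 2)) := by
          have h1 := Real.add_one_le_exp (2 * (l / (x + 1) ^ 2))
          have h2 := mul_le_mul_of_nonneg_left h1 hc0
          nlinarith
        have hm' := hm t ht
        rw [← hx] at hm'
        have hbr : 0 ≤ ((q + T) / x) ^ α + n / ((α - 1) * x) := by positivity
        have hG0 : 0 ≤ G t := by linarith [hG1 t]
        have hcast : q + ((t + 1 : ℕ) : ℝ) = x + 1 := by rw [hx]; push_cast; ring
        rw [hcast]
        calc m (t + 1) ≤ (1 - α / (x + 1) + l / (x + 1) ^ 2) * m t + n / (x + 1) ^ 2 := hm'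
          _ ≤ (1 - α / (x + 1) + l / (x + 1) ^ 2) *
              (G t * (((q + T) / x) ^ α + n / ((α - 1) * x))) + n / (x + 1) ^ 2 := by
            gcongr
          _ ≤ ((1 - α / (x + 1)) * Real.exp (2 * (l / (x + 1) ^ 2))) *
              (G t * (((q + T) / x) ^ α + n / ((α - 1) * x))) +
                G (t + 1) * (n / (x + 1) ^ 2) := by
            gcongr
            exact le_mul_of_one_le_left (by positivity) (hG1 _)
          _ = G (t + 1) * ((1 - α / (x + 1)) * ((q + T) / x) ^ α +
              ((1 - α / (x + 1)) * (n / ((α - 1) * x)) + n / (x + 1) ^ 2)) := by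
            rw [hGs]; ring
          _ ≤ _ := by
            have := hG1 (t + 1)
            gcongr
  refine key.trans ?_
  have hbr : 0 ≤ ((q + T) / (q + t)) ^ α + n / ((α - 1) * (q + t)) := by positivity
  refine mul_le_mul_of_nonneg_right (Real.exp_le_exp.2 ?_) hbr
  calc 2 * l * ∑ s ∈ Finset.range t, 1 / (q + s + 1) ^ 2 ≤ 2 * l * (1 / q) := by
        gcongr; exact sum_range_one_div_sq_le hq t
    _ = 2 * l / q := by ring

end Recursion

section Growth

/-- In logarithms: `log (1 + y) ≥ y - y²`, while `log (x + 1) - log x ≤ 1 / x`. The mismatch `1 / x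
- 1 / (x + 1)` telescopes to at most `1 / q`, and the squares sum to at most `γ² / q`. -/
theorem rpow_mul_exp_le_prod {q γ : ℝ} (hq : 0 < q) (hγ : 0 ≤ γ) (T : ℕ) :
    ((q + T) / q) ^ γ * Real.exp (-((γ + γ ^ 2) / q)) ≤
      ∏ s ∈ Finset.range T, (1 + γ / (q + s + 1)) := by
  have key : ∀ T : ℕ, γ * Real.log ((q + T) / q) - γ * (1 / q - 1 / (q + T)) -
      γ ^ 2 * ∑ s ∈ Finset.range T, 1 / (q + s + 1) ^ 2 ≤
      Real.log (∏ s ∈ Finset.range T, (1 + γ / (q + s + 1))) := by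
    intro T
    induction T with
    | zero => simp [hq.ne']
    | succ T ih =>
      rw [Finset.prod_range_succ, Finset.sum_range_succ, Real.log_mul
        (Finset.prod_pos fun i _ => by positivity).ne' (by positivity)]
      set x : ℝ := q + T with hx
      have hx0 : 0 < x := by positivity
      have hcast : q + ((T + 1 : ℕ) : ℝ) = x + 1 := by rw [hx]; push_cast; ring
      rw [hcast]
      have h1 : Real.log ((x + 1) / q) = Real.log (x / q) + Real.log ((x + 1) / x) := by
        rw [← Real.log_mul (by positivity) (by positivity)]
        congr 1; field_simp
      have h2 : Real.log ((x + 1) / x) ≤ 1 / x := by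
        refine (Real.log_le_sub_one_of_pos (by positivity)).trans (le_of_eq ?_)
        field_simp; ring
      have h3 : γ / (x + 1) - γ ^ 2 * (1 / (x + 1) ^ 2) ≤ Real.log (1 + γ / (x + 1)) := by
        refine le_trans ?_ (Real.one_sub_inv_le_log_of_pos (by positivity))
        have h4 : 1 - (1 + γ / (x + 1))⁻¹ = γ / (x + 1 + γ) := by
          field_simp; ring
        rw [h4, sub_le_iff_le_add]
        have h5 : γ / (x + 1 + γ) + γ ^ 2 * (1 / (x + 1) ^ 2) - γ / (x + 1) =
            γ ^ 3 / ((x + 1) ^ 2 * (x + 1 + γ)) := by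
          field_simp; ring
        have h6 : 0 ≤ γ ^ 3 / ((x + 1) ^ 2 * (x + 1 + γ)) := by positivity
        linarith
      have h7 := mul_le_mul_of_nonneg_left h2 hγ
      rw [h1]
      have h8 : γ * (1 / (x + 1)) = γ / (x + 1) := by ring
      nlinarith
  have hprod : 0 < ∏ s ∈ Finset.range T, (1 + γ / (q + s + 1)) :=
    Finset.prod_pos fun i _ => by positivity
  rw [Real.rpow_def_of_pos (by positivity), ← Real.exp_add, ← Real.le_log_iff_exp_le hprod]
  refine le_trans ?_ (key T)
  have h1 := mul_le_mul_of_nonneg_left (sum_range_one_div_sq_le hq T) (sq_nonneg γ)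
  have h2 : 0 ≤ γ * (1 / (q + T)) := by positivity
  have h3 : (γ + γ ^ 2) / q = γ * (1 / q) + γ ^ 2 * (1 / q) := by ring
  rw [h3]
  nlinarith

/-- A time by which the growth factor reaches `R`, with a bound on how late it is. -/
theorem exists_growth_time {q γ R α : ℝ} (hq : 0 < q) (hγ : 0 < γ) (hR : 1 ≤ R) (hα : 0 ≤ α) :
    ∃ T : ℕ, R ≤ ∏ s ∈ Finset.range T, (1 + γ / (q + s + 1)) ∧
      ((q + T) / q) ^ α ≤ Real.exp (α / γ * ((2 * γ + γ ^ 2) / q)) * R ^ (α / γ) := by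
  set f := (γ + γ ^ 2) / q
  have hf : 0 ≤ f := by positivity
  have hfR : 1 ≤ Real.exp f * R := one_le_mul_of_one_le_of_one_le (Real.one_le_exp hf) hR
  -- The ratio `(q + T) / q` at which the lower bound on the product equals `R`. Rounding `T` up
  -- costs the factor `exp (1 / q)`.
  set X := (Real.exp f * R) ^ (1 / γ)
  have hX1 : 1 ≤ X := Real.one_le_rpow hfR (by positivity)
  refine ⟨⌈q * (X - 1)⌉₊, ?_, ?_⟩
  · refine le_trans ?_ (rpow_mul_exp_le_prod hq hγ.le _)
    have h1 := Nat.le_ceil (q * (X - 1))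
    have h2 : X ≤ (q + ⌈q * (X - 1)⌉₊) / q := by
      rw [le_div_iff₀ hq]; linarith
    have h3 : X ^ γ = Real.exp f * R := by
      rw [← Real.rpow_mul (by linarith), one_div_mul_cancel hγ.ne', Real.rpow_one]
    calc R = X ^ γ * Real.exp (-f) := by
          rw [h3, mul_right_comm, ← Real.exp_add]; simp
      _ ≤ _ := by gcongr
  · have h1 := (Nat.ceil_lt_add_one (a := q * (X - 1)) (by
      have : 0 ≤ X - 1 := by linarith
      positivity)).le
    have h2 : (q + ⌈q * (X - 1)⌉₊) / q ≤ X * Real.exp (1 / q) := by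
      have h3 := Real.add_one_le_exp (1 / q)
      calc (q + ⌈q * (X - 1)⌉₊) / q ≤ (q * X + 1) / q :=
            div_le_div_of_nonneg_right (by linarith) hq.le
        _ = X + 1 / q := by field_simp
        _ ≤ X * (1 / q + 1) := by nlinarith [show 0 < 1 / q by positivity]
        _ ≤ _ := by gcongr
    calc ((q + ⌈q * (X - 1)⌉₊) / q) ^ α ≤ (X * Real.exp (1 / q)) ^ α := by gcongr
      _ = (Real.exp f * R) ^ (α / γ) * Real.exp (α / q) := by
        rw [Real.mul_rpow (by linarith) (Real.exp_pos _).le, ← Real.rpow_mul (by linarith),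
          ← Real.exp_mul]
        congr 2 <;> ring
      _ = Real.exp (f * (α / γ)) * R ^ (α / γ) * Real.exp (α / q) := by
        rw [Real.mul_rpow (Real.exp_pos _).le (by linarith), ← Real.exp_mul]
      _ = _ := by
        rw [mul_right_comm, ← Real.exp_add]
        congr 2
        simp only [f]; field_simp; ring

end Growth

section Comparison

/-- The case `h = 1` is `8 t³ q ≤ (q + t)⁴`. The surplus exponent `4/3` buys the `1/2` in the base,
and with that `1/2` convexity of `x ^ h` splits a sum without a constant exponential in `h`. -/
theorem rpow_div_add_le {q t h : ℝ} (hq : 0 < q) (ht : 0 < t) (hh : 0 ≤ h) :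
    (q / (q + t)) ^ (4 / 3 * h) ≤ (q / (2 * t)) ^ h := by
  rw [Real.rpow_mul (by positivity)]
  refine Real.rpow_le_rpow (by positivity) ?_ hh
  have h1 : (q / (q + t)) ^ (4 / 3 : ℝ) = ((q / (q + t)) ^ 4) ^ (1 / 3 : ℝ) := by
    rw [← Real.rpow_natCast, ← Real.rpow_mul (by positivity)]; norm_num
  have h2 : q / (2 * t) = ((q / (2 * t)) ^ 3) ^ (1 / 3 : ℝ) := by
    rw [← Real.rpow_natCast, ← Real.rpow_mul (by positivity)]; norm_num
  rw [h1, h2]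
  refine Real.rpow_le_rpow (by positivity) ?_ (by norm_num)
  rw [div_pow, div_pow, div_le_div_iff₀ (by positivity) (by positivity)]
  have h3 : 8 * t ^ 3 * q ≤ (q + t) ^ 4 := by
    nlinarith [sq_nonneg ((t - q) ^ 2), mul_pos (pow_pos hq 3) ht]
  calc q ^ 4 * (2 * t) ^ 3 = q ^ 3 * (8 * t ^ 3 * q) := by ring
    _ ≤ q ^ 3 * (q + t) ^ 4 := by gcongr

theorem two_mul_rpow_half_add_le {x y h : ℝ} (hx : 0 ≤ x) (hy : 0 ≤ y) (hh : 1 ≤ h) :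
    2 * ((x + y) / 2) ^ h ≤ x ^ h + y ^ h := by
  have := (convexOn_rpow hh).2 (Set.mem_Ici.2 hx) (Set.mem_Ici.2 hy)
    (show (0 : ℝ) ≤ 1 / 2 by norm_num) (show (0 : ℝ) ≤ 1 / 2 by norm_num) (by norm_num)
  simp only [smul_eq_mul] at this
  have h2 : (x + y) / 2 = 1 / 2 * x + 1 / 2 * y := by ring
  rw [h2]
  linarith

theorem rpow_div_add_le_add {a b t h : ℝ} (ha : 0 < a) (hb : 0 ≤ b) (ht : 0 < t) (hh : 1 ≤ h) :
    ((a + b) / (a + b + t)) ^ (4 / 3 * h) ≤ (a / t) ^ h + (b / t) ^ h := by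
  refine (rpow_div_add_le (by linarith) ht (by linarith)).trans ?_
  have h1 := two_mul_rpow_half_add_le (x := a / t) (y := b / t) (by positivity) (by positivity) hh
  have h2 : (a + b) / (2 * t) = (a / t + b / t) / 2 := by field_simp
  rw [h2]
  have h3 : 0 ≤ ((a / t + b / t) / 2) ^ h := by positivity
  linarith

/-- A mini-batch of size `B ≤ (t B) ^ (1 - 2 / c₀)` leaves `t B ≤ t ^ (c₀ / 2)`. -/
theorem mul_le_rpow_of_le_rpow {t B c₀ : ℝ} (ht : 0 < t) (hB : 0 < B) (hc : 2 < c₀)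
    (h : B ≤ (t * B) ^ (1 - 2 / c₀)) : t * B ≤ t ^ (c₀ / 2) := by
  have h0 : 0 < t * B := by positivity
  rw [Real.rpow_sub h0, Real.rpow_one, le_div_iff₀ (by positivity), mul_comm t B] at h
  have h1 : (B * t) ^ (2 / c₀) ≤ t := le_of_mul_le_mul_left h hB
  have h2 := Real.rpow_le_rpow (by positivity) h1 (show 0 ≤ c₀ / 2 by positivity)
  rw [← Real.rpow_mul (by positivity)] at h2
  have h3 : 2 / c₀ * (c₀ / 2) = 1 := by field_simp
  rwa [h3, Real.rpow_one, mul_comm] at h2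

theorem three_le_five_div_log_two : (3 : ℝ) ≤ 5 / (2 * Real.log 2) := by
  have h1 := Real.log_two_lt_d9
  have h2 := Real.log_two_gt_d9
  rw [le_div_iff₀ (by linarith)]
  linarith

/-- `16/3` is the contraction rate divided by the growth rate. Writing `R ^ (16/3) = (R²) ^ (8/3)`,
the numerical losses are absorbed by `E ^ (1/8) ≥ 6/5`, giving `(E ^ (9/8)) ^ (8/3) = E³`, and `3 ≤
5 / (2 ln 2)`. -/
theorem exp_mul_rpow_le {E s R : ℝ} (hE : 21 ≤ E) (hs : s ≤ 1 / 480) (hR : 0 ≤ R)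
    (hRE : R ^ 2 = 256 / 225 * E) :
    Real.exp (3 * s) * R ^ (16 / 3 : ℝ) ≤ E ^ (5 / (2 * Real.log 2)) := by
  have h1 : R ^ (16 / 3 : ℝ) = (R ^ 2) ^ (8 / 3 : ℝ) := by
    rw [← Real.rpow_natCast, ← Real.rpow_mul hR]; norm_num
  have h2 : Real.exp (3 * s) = Real.exp (9 / 8 * s) ^ (8 / 3 : ℝ) := by
    rw [← Real.exp_mul]; congr 1; ring
  have h3 : Real.exp (9 / 8 * s) ≤ 101 / 100 := by
    have h4 : Real.exp (9 / 8 * s) ≤ Real.exp (1 / 101) := Real.exp_le_exp.2 (by linarith)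
    have h5 := Real.one_sub_le_exp_neg (1 / 101)
    rw [Real.exp_neg] at h5
    refine h4.trans ?_
    rw [← inv_inv (Real.exp (1 / 101))]
    rw [show (101 / 100 : ℝ) = (1 - 1 / 101)⁻¹ by norm_num]
    exact inv_anti₀ (by norm_num) h5
  have h6 : Real.exp (9 / 8 * s) * R ^ 2 ≤ E ^ (9 / 8 : ℝ) := by
    have h7 : (6 / 5 : ℝ) ≤ E ^ (1 / 8 : ℝ) := by
      have : (6 / 5 : ℝ) = ((6 / 5 : ℝ) ^ 8) ^ (1 / 8 : ℝ) := by
        rw [← Real.rpow_natCast, ← Real.rpow_mul (by norm_num)]; norm_num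
      rw [this]
      exact Real.rpow_le_rpow (by norm_num) (by norm_num; linarith) (by norm_num)
    have h8 : E ^ (9 / 8 : ℝ) = E * E ^ (1 / 8 : ℝ) := by
      rw [show (9 / 8 : ℝ) = 1 + 1 / 8 by norm_num, Real.rpow_add (by linarith), Real.rpow_one]
    rw [h8, hRE]
    calc Real.exp (9 / 8 * s) * (256 / 225 * E) ≤ 101 / 100 * (256 / 225 * E) := by gcongr
      _ ≤ E * (6 / 5) := by linarith
      _ ≤ _ := by gcongr
  rw [h1, h2, ← Real.mul_rpow (Real.exp_pos _).le (by positivity)]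
  calc (Real.exp (9 / 8 * s) * R ^ 2) ^ (8 / 3 : ℝ) ≤ (E ^ (9 / 8 : ℝ)) ^ (8 / 3 : ℝ) := by
        gcongr
    _ = E ^ (3 : ℝ) := by rw [← Real.rpow_mul (by linarith)]; norm_num
    _ ≤ _ := Real.rpow_le_rpow_of_exponent_le (by linarith) three_le_five_div_log_two

end Comparison

end DMKrasulina

/-! ### Probability of alignment, excess risk, and the parameters. -/

namespace DMKrasulina

variable {d : ℕ}

namespace IsKrasulina

variable {Ω : Type*} [mΩ : MeasurableSpace Ω] {ι : Type*} [Fintype ι] [Nonempty ι]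
  {P : Measure Ω} [IsProbabilityMeasure P] {D : Measure (Vec d)} [IsProbabilityMeasure D]
  {ℱ : ℕ → MeasurableSpace Ω} {Y : ℕ → Ω → ι → Vec d} {w : ℕ → Ω → Vec d}
  {κ c q : ℝ} {e : Vec d} {lam g : ℝ}

/-- Two bad events of probability `δ / 2` each: a start in the slab of half-width `a`, and noise
beyond `a / 16`. The product required of `T` is the reciprocal of `a - a / 16`. -/
theorem prob_aligned_ge (h : IsKrasulina P D ℱ Y (fun s => c / (q + s)) w)
    (hκ : ∀ᵐ x ∂D, ‖x‖ ≤ κ) (he : IsTopEigenvector (covOp D) e lam g) (hg : 0 ≤ g)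
    (hc : 0 ≤ c) (hq : 0 < q) (hs : c ^ 2 * κ ^ 4 / q ≤ 1 / 480) {a δ : ℝ} (ha : 0 < a)
    (ha' : a ≤ 1 / 4) (hδ : 0 ≤ δ)
    (hstart : P {ω | |inner ℝ e (w 0 ω)| < a} ≤ ENNReal.ofReal (δ / 2))
    (hnoise : 101 / 100 * (c ^ 2 * covNoise D ι / q) ≤ δ / 2 * (a / 16) ^ 2) {T : ℕ}
    (hT : 16 / (15 * a) ≤ ∏ s ∈ Finset.range T, (1 + c * g / 4 / (q + s + 1))) :
    1 - δ ≤ P.real (⋂ t, aligned e w T t) := by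
  have hη : ∀ t : ℕ, 0 ≤ c / (q + t) := fun t => by positivity
  have hS : ∀ s t : ℕ, ∑ r ∈ Finset.Ico s t, (c / (q + (r + 1 : ℕ))) ^ 2 * κ ^ 4 ≤
      c ^ 2 * κ ^ 4 / q := by
    intro s t
    calc ∑ r ∈ Finset.Ico s t, (c / (q + (r + 1 : ℕ))) ^ 2 * κ ^ 4
        = c ^ 2 * κ ^ 4 * ∑ r ∈ Finset.Ico s t, 1 / (q + r + 1) ^ 2 := by
          rw [Finset.mul_sum]
          refine Finset.sum_congr rfl fun r _ => ?_
          push_cast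
          rw [div_pow, ← add_assoc]; ring
      _ ≤ c ^ 2 * κ ^ 4 * (1 / q) := by gcongr; exact sum_Ico_one_div_sq_le hq s t
      _ = _ := by ring
  have hexp : Real.exp (c ^ 2 * κ ^ 4 / q) ≤ 101 / 100 := by
    refine (Real.exp_le_exp.2 hs).trans ?_
    have h5 := Real.one_sub_le_exp_neg (1 / 480)
    rw [Real.exp_neg] at h5
    have h6 := inv_anti₀ (by norm_num) h5
    rw [inv_inv] at h6
    exact h6.trans (by norm_num)
  have hR : ∀ᵐ ω ∂P, ∀ t, ‖w t ω‖ ^ 2 ≤ 101 / 100 := by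
    filter_upwards [h.ae_bound hκ, h.norm_init] with ω h1 h2 t
    refine (h.norm_sq_le_exp h1 (Nat.zero_le t)).trans ?_
    rw [h2, one_pow, mul_one]
    exact (Real.exp_le_exp.2 (hS 0 t)).trans hexp
  have hr : 0 < a / 16 := by positivity
  have hv := covNoise_nonneg D ι
  have hbad := h.measure_stoppedNoise_gt_le hκ he hr hR
    (K := 101 / 100 * (c ^ 2 * covNoise D ι / q)) (fun t => by
      calc ∑ s ∈ Finset.range t, (c / (q + (s + 1 : ℕ))) ^ 2 * (covNoise D ι * (101 / 100))
          = c ^ 2 * (covNoise D ι * (101 / 100)) * ∑ s ∈ Finset.range t, 1 / (q + s + 1) ^ 2 := by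
            rw [Finset.mul_sum]
            refine Finset.sum_congr rfl fun r _ => ?_
            push_cast
            rw [div_pow, ← add_assoc]; ring
        _ ≤ c ^ 2 * (covNoise D ι * (101 / 100)) * (1 / q) := by
          gcongr; exact sum_range_one_div_sq_le hq t
        _ = _ := by ring)
  have hbad' : P {ω | ∃ t, a / 16 <
      |stoppedNoise D e (fun s => c / (q + s)) w Y (a / 16) t ω|} ≤ ENNReal.ofReal (δ / 2) :=
    hbad.trans (ENNReal.ofReal_le_ofReal (by rwa [div_le_iff₀ (by positivity)]))
  have hmeas : MeasurableSet (⋂ t, aligned e w T t) :=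
    MeasurableSet.iInter fun t => h.innovation.le _ _ (h.measurableSet_aligned e T t)
  have hsub : P (⋂ t, aligned e w T t)ᶜ ≤ P ({ω | |inner ℝ e (w 0 ω)| < a} ∪
      {ω | ∃ t, a / 16 < |stoppedNoise D e (fun s => c / (q + s)) w Y (a / 16) t ω|}) := by
    refine measure_mono_ae ?_
    filter_upwards [h.ae_bound hκ, h.norm_init] with ω h1 h2 hω
    by_contra hcon
    refine hω ?_
    have hcon' : ¬ (|inner ℝ e (w 0 ω)| < a ∨
      ∃ t, a / 16 < |stoppedNoise D e (fun s => c / (q + s)) w Y (a / 16) t ω|) := hcon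
    push Not at hcon'
    obtain ⟨h3, h4⟩ := hcon'
    refine Set.mem_iInter.2 fun t s hs _ => ?_
    refine h.sinSq_le_third he hg hη h1 h2 hS hexp (by linarith) h4 (by linarith) ?_ hs
    have h5 : ∏ s ∈ Finset.range T, (1 + c / (q + (s + 1 : ℕ)) * g / 4) =
        ∏ s ∈ Finset.range T, (1 + c * g / 4 / (q + s + 1)) := by
      refine Finset.prod_congr rfl fun s _ => ?_
      push_cast
      rw [← add_assoc]; ring
    rw [h5]
    calc (1 : ℝ) = (a - a / 16) * (16 / (15 * a)) := by field_simp; norm_num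
      _ ≤ _ := by
        gcongr
        linarith
  have h6 : P (⋂ t, aligned e w T t)ᶜ ≤ ENNReal.ofReal δ := by
    refine hsub.trans ((measure_union_le _ _).trans ?_)
    calc _ ≤ ENNReal.ofReal (δ / 2) + ENNReal.ofReal (δ / 2) := add_le_add hstart hbad'
      _ = ENNReal.ofReal δ := by
        rw [← ENNReal.ofReal_add (by positivity) (by positivity), add_halves]
  have h7 : P.real (⋂ t, aligned e w T t)ᶜ ≤ δ := ENNReal.toReal_le_of_le_ofReal hδ h6
  rw [probReal_compl_eq_one_sub hmeas] at h7
  linarith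

theorem condSinSq_le (h : IsKrasulina P D ℱ Y (fun s => c / (q + s)) w)
    (hκ : ∀ᵐ x ∂D, ‖x‖ ≤ κ) (he : IsTopEigenvector (covOp D) e lam g) (hg : 0 ≤ g)
    (hc : 0 ≤ c) (hq : 0 < q) {α : ℝ} (hα : α = 4 / 3 * (c * g)) (hα1 : 1 < α)
    (hαq : α / q ≤ 1 / 2) {T : ℕ} (hpos : ∀ t, 0 < P.real (aligned e w T t)) (t : ℕ) :
    condSinSq P e w T t ≤ Real.exp (2 * (c ^ 2 * lam ^ 2) / q) *
      (((q + T) / (q + t)) ^ α + c ^ 2 * covNoise D ι / ((α - 1) * (q + t))) := by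
  have hv := covNoise_nonneg D ι
  refine le_of_contraction hq hα1 hαq (by positivity) (by positivity)
    (h.condSinSq_le_one he.norm_eq T) (fun t ht => ?_) t
  have hcast : q + ((t + 1 : ℕ) : ℝ) = q + t + 1 := by push_cast; ring
  have h1 : α / (q + t + 1) ≤ 1 / 2 := by
    refine le_trans ?_ hαq
    have : (0 : ℝ) ≤ t := t.cast_nonneg
    exact div_le_div_of_nonneg_left (by linarith) hq (by linarith)
  have h2 : 4 / 3 * (c / (q + ((t + 1 : ℕ) : ℝ)) * g) = α / (q + t + 1) := by
    rw [hcast, hα]; ring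
  have h3 : (c / (q + ((t + 1 : ℕ) : ℝ))) ^ 2 = c ^ 2 / (q + t + 1) ^ 2 := by
    rw [hcast, div_pow]
  have h4 := h.condSinSq_succ_le hκ he hg ht (by positivity) (hpos _) (by
    rw [h2]
    have : 0 ≤ (c / (q + ((t + 1 : ℕ) : ℝ))) ^ 2 * lam ^ 2 := by positivity
    linarith)
  rw [h2, h3] at h4
  refine h4.trans (le_of_eq ?_)
  ring

end IsKrasulina

section Risk

variable {D : Measure (Vec d)} {e : Vec d} {lam g : ℝ}

theorem IsTopEigenvector.inner_apply_le {S : Vec d →ₗ[ℝ] Vec d}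
    (he : IsTopEigenvector S e lam g) (hg : 0 ≤ g) (w : Vec d) :
    inner ℝ w (S w) ≤ lam * ‖w‖ ^ 2 := by
  have h1 := he.gap_mul_le w
  have h2 := inner_sq_le_norm_sq he.norm_eq w
  nlinarith [mul_nonneg hg (sub_nonneg.2 h2)]

variable [IsProbabilityMeasure D] {κ : ℝ}

theorem risk_eq (hκ : ∀ᵐ x ∂D, ‖x‖ ≤ κ) (w : Vec d) :
    risk D w = -(inner ℝ w (covOp D w) / ‖w‖ ^ 2) := by
  simp only [risk, loss]
  rw [integral_neg, integral_div, inner_covOp_self hκ]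

theorem neg_le_risk (hκ : ∀ᵐ x ∂D, ‖x‖ ≤ κ) (he : IsTopEigenvector (covOp D) e lam g)
    (hg : 0 ≤ g) {w : Vec d} (hw : w ≠ 0) : -lam ≤ risk D w := by
  rw [risk_eq hκ, neg_le_neg_iff, div_le_iff₀ (by positivity)]
  exact he.inner_apply_le hg w

theorem risk_le_sinSq (hκ : ∀ᵐ x ∂D, ‖x‖ ≤ κ) (he : IsTopEigenvector (covOp D) e lam g)
    {w : Vec d} (hw : w ≠ 0) : risk D w ≤ -lam + lam * sinSq e w := by
  have hn : 0 < ‖w‖ ^ 2 := by positivity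
  have h1 := he.le_mul w
  have h2 : lam * (‖w‖ ^ 2 - (inner ℝ e w) ^ 2) = lam * sinSq e w * ‖w‖ ^ 2 := by
    rw [sinSq]; field_simp
  have h3 : lam - lam * sinSq e w ≤ inner ℝ w (covOp D w) / ‖w‖ ^ 2 := by
    rw [le_div_iff₀ hn]; linarith
  rw [risk_eq hκ]
  linarith

theorem abs_risk_le (hκ : ∀ᵐ x ∂D, ‖x‖ ≤ κ) (w : Vec d) : |risk D w| ≤ κ ^ 2 := by
  have h1 := inner_covOp_self_nonneg hκ w
  rw [risk_eq hκ, abs_neg, abs_of_nonneg (by positivity)]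
  exact div_le_of_le_mul₀ (sq_nonneg _) (sq_nonneg _) (inner_covOp_self_le hκ w)

theorem measurable_risk (hκ : ∀ᵐ x ∂D, ‖x‖ ≤ κ) : Measurable (risk D) := by
  have h1 : Measurable (covOp D) := (covOp D).continuous_of_finiteDimensional.measurable
  have h2 : risk D = fun w => -(inner ℝ w (covOp D w) / ‖w‖ ^ 2) := funext (risk_eq hκ)
  rw [h2]
  fun_prop

/-- Combines `risk ≤ -λ + λ sin²` along the iterates with the lower bound `-λ` for the risk of the
comparison vector. -/
theorem IsKrasulina.condExcessRisk_le {Ω : Type*} [MeasurableSpace Ω] {ι : Type*} [Fintype ι]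
    {P : Measure Ω} [IsProbabilityMeasure P] {ℱ : ℕ → MeasurableSpace Ω} {Y : ℕ → Ω → ι → Vec d}
    {w : ℕ → Ω → Vec d} {η : ℕ → ℝ} (h : IsKrasulina P D ℱ Y η w) (hκ : ∀ᵐ x ∂D, ‖x‖ ≤ κ)
    (he : IsTopEigenvector (covOp D) e lam g) (hg : 0 ≤ g) {T t : ℕ}
    (hpos : 0 < P.real (aligned e w T t)) {wstar : Vec d} (hw : wstar ≠ 0) :
    condExcessRisk P (aligned e w T t) D (w t) wstar ≤ lam * condSinSq P e w T t := by
  have hInt : Integrable (fun ω => risk D (w t ω)) P :=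
    integrable_of_ae_bound ((measurable_risk hκ).comp (h.measurable' t)) (κ ^ 2)
      (.of_forall fun ω => abs_risk_le hκ _)
  have hInt2 := (h.integrable_sinSq he.norm_eq t).const_mul lam
  set A := aligned e w T t
  have h1 : ∫ ω in A, risk D (w t ω) ∂P ≤ ∫ ω in A, (-lam + lam * sinSq e (w t ω)) ∂P := by
    refine integral_mono_ae hInt.integrableOn ((integrable_const _).add hInt2).integrableOn ?_
    refine ae_restrict_of_ae ?_
    filter_upwards [h.norm_init] with ω hω
    exact risk_le_sinSq hκ he (h.ne_zero hω t)
  have h2 : ∫ ω in A, (-lam + lam * sinSq e (w t ω)) ∂P =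
      -lam * P.real A + lam * ∫ ω in A, sinSq e (w t ω) ∂P := by
    rw [integral_add (integrable_const _).integrableOn hInt2.integrableOn, integral_const_mul]
    simp [mul_comm]
  have h3 : ∫ ω, risk D (w t ω) ∂(P[|A]) = (∫ ω in A, risk D (w t ω) ∂P) / P.real A := by
    rw [ProbabilityTheory.cond, integral_smul_measure, ENNReal.toReal_inv, smul_eq_mul,
      measureReal_def]
    ring
  rw [condExcessRisk, h3, IsKrasulina.condSinSq]
  have h4 := neg_le_risk hκ he hg hw
  have h5 : (∫ ω in A, risk D (w t ω) ∂P) / P.real A ≤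
      -lam + lam * ((∫ ω in A, sinSq e (w t ω) ∂P) / P.real A) := by
    rw [div_le_iff₀ hpos]
    refine (h1.trans_eq h2).trans (le_of_eq ?_)
    field_simp
  linarith

end Risk

section Parameters

theorem log_four_div_ge {δ : ℝ} (hδ0 : 0 < δ) (hδ1 : δ < 1) : 693 / 500 ≤ Real.log (4 / δ) := by
  have h1 : Real.log 4 = 2 * Real.log 2 := by
    rw [show (4 : ℝ) = 2 ^ 2 by norm_num, Real.log_pow]; norm_num
  have h2 : Real.log 4 ≤ Real.log (4 / δ) := by
    refine Real.log_le_log (by norm_num) ?_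
    rw [le_div_iff₀ hδ0]; linarith
  linarith [Real.log_two_gt_d9]

theorem exp_one_mul_ge (hd : 2 ≤ d) : 543 / 100 ≤ Real.exp 1 * d := by
  have h1 := Real.exp_one_gt_d9
  have h2 : (2 : ℝ) ≤ d := by exact_mod_cast hd
  nlinarith

variable {κ c δ : ℝ}

theorem Q₁_pos (hd : 2 ≤ d) (hκ : 0 < κ) (hδ0 : 0 < δ) (hδ1 : δ < 1) : 0 < Q₁ d κ c δ := by
  have h1 := log_four_div_ge hδ0 hδ1
  have h2 : (0 : ℝ) < d := by exact_mod_cast (by omega : 0 < d)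
  have h3 : 0 < Real.log (4 / δ) := by linarith
  have h4 : 0 < max 1 (c ^ 2) := lt_max_of_lt_left one_pos
  rw [Q₁]
  positivity

/-- `480` lies just below `64 * 2e * ln 4`. This is what the size of `Q₁` buys: the norm growth
stays under 1%. -/
theorem sq_mul_div_le_of_Q₁_le (hd : 2 ≤ d) (hκ : 0 < κ) (hδ0 : 0 < δ) (hδ1 : δ < 1) {q : ℝ}
    (hq : Q₁ d κ c δ ≤ q) : c ^ 2 * κ ^ 4 / q ≤ 1 / 480 := by
  have h0 := Q₁_pos (c := c) hd hκ hδ0 hδ1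
  have h1 := log_four_div_ge hδ0 hδ1
  have h2 := exp_one_mul_ge hd
  have h3 : 480 ≤ 64 * (Real.exp 1 * d) * Real.log (4 / δ) := by nlinarith
  have h4 : 480 * (c ^ 2 * κ ^ 4) ≤ Q₁ d κ c δ := by
    have h5 : δ ^ 2 ≤ 1 := by nlinarith
    have h6 : Q₁ d κ c δ = 64 * (Real.exp 1 * d) * Real.log (4 / δ) *
        (max 1 (c ^ 2) * κ ^ 4) / δ ^ 2 := by rw [Q₁]; ring
    rw [h6, le_div_iff₀ (by positivity)]
    calc 480 * (c ^ 2 * κ ^ 4) * δ ^ 2 ≤ 480 * (c ^ 2 * κ ^ 4) * 1 := by gcongr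
      _ = 480 * (c ^ 2 * κ ^ 4) := mul_one _
      _ ≤ _ := by
        gcongr
        exact le_max_right _ _
  rw [div_le_iff₀ (h0.trans_le hq)]
  linarith

/-- The right-hand side is `(δ / 2) (a / 16)²` with `a² = δ² / (4 e d)`, the threshold needed in
Kolmogorov's inequality. -/
theorem noise_le_of_Q₂_le (hd : 2 ≤ d) (hδ0 : 0 < δ) (hδ1 : δ < 1) {q v Q₂' : ℝ} (hv : 0 ≤ v)
    (hq0 : 0 < q) (hQ₂' : Q₂ d v c δ / v ≤ Q₂') (hq : v * Q₂' ≤ q) :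
    101 / 100 * (c ^ 2 * v / q) ≤ δ / 2 * (δ ^ 2 / (4 * (Real.exp 1 * d)) / 256) := by
  have h1 := log_four_div_ge hδ0 hδ1
  have h2 := exp_one_mul_ge hd
  -- For `v = 0` the quotient `Q₂ / v` is `0` by convention, but there is no noise to control.
  rcases hv.eq_or_lt with rfl | hv0
  · simp only [mul_zero, zero_div]
    positivity
  set x := Real.exp 1 * d with hx
  set l := Real.log (4 / δ)
  have hx0 : 0 < x := by linarith
  have h3 : 512 * x ^ 2 * l * (c ^ 2 * v) ≤ q * δ ^ 4 := by
    rw [div_le_iff₀ hv0, mul_comm] at hQ₂'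
    have h4 : Q₂ d v c δ = 512 * x ^ 2 * l * (max 1 (c ^ 2) * v) / δ ^ 4 := by
      rw [Q₂, hx]; ring
    have h5 := hQ₂'.trans hq
    rw [h4, div_le_iff₀ (by positivity)] at h5
    refine le_trans ?_ h5
    gcongr
    exact le_max_right _ _
  have h6 : 7 ≤ x * l := by nlinarith
  have h7 : 3584 * x * (c ^ 2 * v) ≤ q * δ ^ 4 := by
    refine le_trans ?_ h3
    have h8 : 512 * x ^ 2 * l * (c ^ 2 * v) = 512 * (x * l) * (x * (c ^ 2 * v)) := by ring
    have h9 : 0 ≤ x * (c ^ 2 * v) := by positivity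
    rw [h8]
    nlinarith
  have h10 : q * δ ^ 4 ≤ q * δ ^ 3 := by
    have : δ ^ 4 ≤ δ ^ 3 := pow_le_pow_of_le_one hδ0.le hδ1.le (by norm_num)
    gcongr
  have h11 : 101 / 100 * (c ^ 2 * v / q) = 101 / 100 * (c ^ 2 * v) / q := by ring
  have h12 : δ / 2 * (δ ^ 2 / (4 * x) / 256) = δ ^ 3 / (2048 * x) := by field_simp; norm_num
  rw [h11, h12, div_le_div_iff₀ hq0 (by positivity)]
  nlinarith [show 0 ≤ x * (c ^ 2 * v) by positivity]

theorem C₁_antitone {lam q q' : ℝ} (hlam : 0 ≤ lam) (hq : 0 < q) (h : q ≤ q') :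
    C₁ d lam c δ q' ≤ C₁ d lam c δ q := by
  unfold C₁
  gcongr

theorem C₂_antitone {lam c₀ q q' : ℝ} (hlam : 0 ≤ lam) (hc₀ : 2 < c₀) (hq : 0 < q) (h : q ≤ q') :
    C₂ lam c₀ c q' ≤ C₂ lam c₀ c q := by
  have : 0 < c₀ - 2 := by linarith
  unfold C₂
  gcongr

/-- Comparison of the solved recursion with the stated rate. -/
theorem rate_le {lam c₀ α v σ Q₁' Q₂' q m : ℝ} {t B T : ℕ} (hlam : 0 ≤ lam) (hc₀ : 2 < c₀)
    (hα : α = 4 / 3 * (c₀ / 2)) (hv : 0 ≤ v) (hQ₁' : 0 < Q₁') (hQ₂' : 0 ≤ Q₂')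
    (hq : q = Q₁' + v * Q₂') (ht : 0 < t) (hB : 0 < B) (hvσ : v ≤ σ ^ 2 / B)
    (hT : ((q + T) / q) ^ α ≤ (4 * Real.exp 1 * d / δ ^ 2) ^ (5 / (2 * Real.log 2)))
    (hBt : (B : ℝ) ≤ ((t * B : ℕ) : ℝ) ^ (1 - 2 / c₀))
    (hm : m ≤ Real.exp (2 * (c ^ 2 * lam ^ 2) / q) *
      (((q + T) / (q + t)) ^ α + c ^ 2 * v / ((α - 1) * (q + t)))) :
    lam * m ≤ c₀ * C₁ d lam c δ q * (Q₁' ^ (c₀ / 2) / (t * B : ℕ)) +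
      c₀ * C₁ d lam c δ q * (σ ^ 2 * Q₂' / (t * B : ℕ)) ^ (c₀ / 2) +
      C₂ lam c₀ c q * σ ^ 2 / (t * B : ℕ) := by
  have ht' : (0 : ℝ) < t := by exact_mod_cast ht
  have hB' : (0 : ℝ) < B := by exact_mod_cast hB
  have hq0 : 0 < q := by rw [hq]; positivity
  push_cast at hBt ⊢
  set X := Real.exp (2 * (c ^ 2 * lam ^ 2) / q) with hX
  set E := (4 * Real.exp 1 * d / δ ^ 2) ^ (5 / (2 * Real.log 2)) with hE
  have hE0 : 0 ≤ E := by positivity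
  have hX0 : 0 < X := Real.exp_pos _
  set S := Q₁' ^ (c₀ / 2) / ((t : ℝ) * B) + (σ ^ 2 * Q₂' / ((t : ℝ) * B)) ^ (c₀ / 2) with hS
  have hS0 : 0 ≤ S := by positivity
  -- The burn-in factor `(q + T) / q` goes into `E`, the decay `q / (q + t)` into `S`.
  have h1 : ((q + T) / (q + t)) ^ α ≤ E * S := by
    have h2 : (q + T) / (q + t) = (q + T) / q * (q / (q + t)) := by field_simp
    rw [h2, Real.mul_rpow (by positivity) (by positivity)]
    refine mul_le_mul hT ?_ (by positivity) hE0
    rw [hα]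
    have h3 := rpow_div_add_le_add (a := Q₁') (b := v * Q₂') (t := t) (h := c₀ / 2) hQ₁'
      (by positivity) ht' (by linarith)
    rw [← hq] at h3
    refine h3.trans (add_le_add ?_ ?_)
    · rw [Real.div_rpow hQ₁'.le ht'.le]
      have h4 := mul_le_rpow_of_le_rpow ht' hB' hc₀ hBt
      gcongr
    · refine Real.rpow_le_rpow (by positivity) ?_ (by linarith)
      have h5 : σ ^ 2 * Q₂' / (t * B) = σ ^ 2 / B * Q₂' / t := by field_simp
      rw [h5]
      gcongr
  have h6 : X * (E * S) * lam ≤ c₀ * C₁ d lam c δ q * S := by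
    have h7 : C₁ d lam c δ q = lam / 2 * E * X := by
      rw [C₁, ← hE, hX]; congr 2; ring
    rw [h7]
    have h8 : 0 ≤ lam * E * X * S := by positivity
    nlinarith
  have hα1 : 0 < α - 1 := by rw [hα]; linarith
  have hc2 : 0 < c₀ - 2 := by linarith
  have h9 : X * (c ^ 2 * v / ((α - 1) * (q + t))) * lam ≤
      C₂ lam c₀ c q * σ ^ 2 / (t * B) := by
    have h10 : v / (q + t) ≤ σ ^ 2 / (t * B) := by
      calc v / (q + t) ≤ (σ ^ 2 / B) / t :=
            div_le_div₀ (by positivity) hvσ ht' (by linarith)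
        _ = _ := by field_simp
    -- `α - 1 = 2 c₀ / 3 - 1` exceeds `(c₀ - 2) / 2`.
    have h11 : 1 / (α - 1) ≤ 2 / (c₀ - 2) := by
      rw [div_le_div_iff₀ hα1 hc2, hα]; linarith
    have h12 : X ≤ Real.exp ((c₀ + 2 * c ^ 2 * lam ^ 2) / q) := by
      rw [hX]
      refine Real.exp_le_exp.2 (div_le_div_of_nonneg_right ?_ hq0.le)
      nlinarith
    calc X * (c ^ 2 * v / ((α - 1) * (q + t))) * lam
        = c ^ 2 * lam * X * (1 / (α - 1)) * (v / (q + t)) := by field_simp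
      _ ≤ c ^ 2 * lam * Real.exp ((c₀ + 2 * c ^ 2 * lam ^ 2) / q) * (2 / (c₀ - 2)) *
          (σ ^ 2 / (t * B)) := by gcongr
      _ = _ := by rw [C₂]; ring
  calc lam * m ≤ lam * (X * (((q + T) / (q + t)) ^ α + c ^ 2 * v / ((α - 1) * (q + t)))) := by
        gcongr
    _ ≤ lam * (X * (E * S + c ^ 2 * v / ((α - 1) * (q + t)))) := by gcongr
    _ = X * (E * S) * lam + X * (c ^ 2 * v / ((α - 1) * (q + t))) * lam := by ring
    _ ≤ c₀ * C₁ d lam c δ q * S + C₂ lam c₀ c q * σ ^ 2 / (t * B) := add_le_add h6 h9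
    _ = _ := by rw [hS]; ring

/-- `C₁` and `C₂` decrease in `Q`, so `Q` may be lowered to `Q₁'`, which removes `σ_B²`; `t' ≥ 1`
and `c₀ / 2 ≥ 1` reduce the middle power to `1 / t'`. -/
theorem uniform_rate_le {lam c₀ σ Q₁' Q₂' q t' : ℝ} (hlam : 0 ≤ lam) (hc₀ : 2 < c₀)
    (hQ₁' : 0 < Q₁') (hQ₂' : 0 ≤ Q₂') (hq : Q₁' ≤ q) (ht' : 1 ≤ t') :
    c₀ * C₁ d lam c δ q * (Q₁' ^ (c₀ / 2) / t') +
      c₀ * C₁ d lam c δ q * (σ ^ 2 * Q₂' / t') ^ (c₀ / 2) + C₂ lam c₀ c q * σ ^ 2 / t' ≤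
    (c₀ * C₁ d lam c δ Q₁' * Q₁' ^ (c₀ / 2) +
      c₀ * C₁ d lam c δ Q₁' * (σ ^ 2 * Q₂') ^ (c₀ / 2) + C₂ lam c₀ c Q₁' * σ ^ 2) / t' := by
  have h1 := C₁_antitone (d := d) (c := c) (δ := δ) hlam hQ₁' hq
  have h2 := C₂_antitone (c := c) hlam hc₀ hQ₁' hq
  have h3 : 0 ≤ C₁ d lam c δ q := by unfold C₁; positivity
  have h4 : (σ ^ 2 * Q₂' / t') ^ (c₀ / 2) ≤ (σ ^ 2 * Q₂') ^ (c₀ / 2) / t' := by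
    rw [Real.div_rpow (by positivity) (by linarith)]
    have h5 : t' ≤ t' ^ (c₀ / 2) := by
      simpa using Real.rpow_le_rpow_of_exponent_le ht' (show 1 ≤ c₀ / 2 by linarith)
    gcongr
  have hc : 0 ≤ c₀ := by linarith
  have h6 : 0 ≤ c₀ * C₁ d lam c δ Q₁' := mul_nonneg hc (h3.trans h1)
  calc _ ≤ c₀ * C₁ d lam c δ Q₁' * (Q₁' ^ (c₀ / 2) / t') +
        c₀ * C₁ d lam c δ Q₁' * ((σ ^ 2 * Q₂') ^ (c₀ / 2) / t') +
        C₂ lam c₀ c Q₁' * σ ^ 2 / t' := by gcongr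
    _ = _ := by ring

end Parameters

theorem batchVar_eq_covNoise (D : Measure (Vec d)) {N B : ℕ} (hNB : N ∣ B) :
    batchVar D N B = covNoise D (Fin N × Fin (B / N)) := by
  have hc : (Fintype.card (Fin N × Fin (B / N)) : ℝ) = B := by
    rw [Fintype.card_prod, Fintype.card_fin, Fintype.card_fin, Nat.mul_div_cancel' hNB]
  simp only [batchVar, covNoise, sampleCov, hc, Fintype.sum_prod_type]

end DMKrasulina

/-! ### Choice of the burn-in time and assembly. -/

namespace DMKrasulina

/-- Growth rate `c g / 4` and contraction rate `4 c g / 3` have the absolute ratio `16/3`, so the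
cost of the burn-in is a fixed power of `1 / a² = 4 e d / δ²`, whatever the gap. -/
theorem exists_burn_in_time {d : ℕ} {Q c g κ a δ : ℝ} (hQ0 : 0 < Q) (hcg1 : 1 ≤ c * g)
    (hcgκ : (c * g) ^ 2 ≤ c ^ 2 * κ ^ 4) (hs : c ^ 2 * κ ^ 4 / Q ≤ 1 / 480) (ha0 : 0 < a)
    (ha4 : a ≤ 1 / 4) (hδ0 : 0 < δ) (hδ1 : δ < 1) (hd : 2 ≤ d)
    (ha2 : a ^ 2 = δ ^ 2 / (4 * (Real.exp 1 * d))) :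
    ∃ T : ℕ, 16 / (15 * a) ≤ ∏ s ∈ Finset.range T, (1 + c * g / 4 / (Q + s + 1)) ∧
      ((Q + T) / Q) ^ (4 / 3 * (c * g)) ≤
        (4 * Real.exp 1 * d / δ ^ 2) ^ (5 / (2 * Real.log 2)) := by
  have hed := exp_one_mul_ge hd
  have hd0 : (0 : ℝ) < d := by exact_mod_cast (by omega : 0 < d)
  have hR1 : 1 ≤ 16 / (15 * a) := by
    rw [le_div_iff₀ (by positivity)]; linarith
  obtain ⟨T, hT1, hT2⟩ := exists_growth_time (q := Q) (γ := c * g / 4) (R := 16 / (15 * a))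
    (α := 4 / 3 * (c * g)) hQ0 (by positivity) hR1 (by positivity)
  have hratio : 4 / 3 * (c * g) / (c * g / 4) = 16 / 3 := by
    rw [div_eq_iff (by positivity)]; ring
  refine ⟨T, hT1, hT2.trans ?_⟩
  rw [hratio]
  have hE : 21 ≤ 4 * Real.exp 1 * d / δ ^ 2 := by
    rw [le_div_iff₀ (by positivity)]
    nlinarith
  refine le_trans ?_ (exp_mul_rpow_le hE hs (R := 16 / (15 * a)) (by positivity) ?_)
  · refine mul_le_mul_of_nonneg_right (Real.exp_le_exp.2 ?_) (by positivity)
    have h1 : 16 / 3 * ((2 * (c * g / 4) + (c * g / 4) ^ 2) / Q) =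
        (8 / 3 * (c * g) + 1 / 3 * (c * g) ^ 2) / Q := by ring
    have h2 : 3 * (c ^ 2 * κ ^ 4 / Q) = 3 * (c ^ 2 * κ ^ 4) / Q := by ring
    rw [h1, h2]
    refine div_le_div_of_nonneg_right ?_ hQ0.le
    nlinarith
  · rw [div_pow, mul_pow, ha2]; field_simp; norm_num

/-- The conclusion for an abstract Krasulina process whose batches have `B` samples. -/
theorem IsKrasulina.exists_events_rate {Ω : Type*} [MeasurableSpace Ω] {P : Measure Ω}
    [IsProbabilityMeasure P] {ι : Type*} [Fintype ι] [Nonempty ι] {d : ℕ} (hd : 2 ≤ d)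
    {D : Measure (Vec d)} [IsProbabilityMeasure D] {κ : ℝ} (hκ : ∀ᵐ x ∂D, ‖x‖ ≤ κ)
    {ℱ : ℕ → MeasurableSpace Ω} {Y : ℕ → Ω → ι → Vec d} {w : ℕ → Ω → Vec d}
    {δ c₀ c σ g lam Q₁' Q₂' Q v : ℝ} {e : Vec d} {B : ℕ}
    (hK : IsKrasulina P D ℱ Y (fun s => c / (Q + s)) w)
    (he : IsTopEigenvector (covOp D) e lam g) (hgap : 0 < g) (hglam : g ≤ lam)
    (hlamκ : lam ≤ κ ^ 2)
    (hB : 0 < B) (hδ0 : 0 < δ) (hδ1 : δ < 1) (hc₀ : 2 < c₀) (hc : c = c₀ / (2 * g))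
    (hv : v = covNoise D ι) (hvσ : v ≤ σ ^ 2 / B)
    (hQ₁' : Q₁ d κ c δ ≤ Q₁') (hQ₂' : Q₂ d v c δ / v ≤ Q₂') (hQ : Q = Q₁' + v * Q₂')
    (hstart : P {ω | |inner ℝ e (w 0 ω)| < δ / (2 * (Real.exp (1 / 2) * √d))} ≤
      ENNReal.ofReal (δ / 2))
    {wstar : Vec d} (hwstar0 : wstar ≠ 0) :
    ∃ Ω' : ℕ → Set Ω,
      (∀ t, MeasurableSet (Ω' t)) ∧ Antitone Ω' ∧ 1 - δ ≤ P.real (⋂ t, Ω' t) ∧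
      ∀ t t' : ℕ, 0 < t → t' = t * B → (B : ℝ) ≤ (t' : ℝ) ^ (1 - 2 / c₀) →
        condExcessRisk P (Ω' t) D (w t) wstar ≤
            c₀ * C₁ d lam c δ Q * (Q₁' ^ (c₀ / 2) / t') +
              c₀ * C₁ d lam c δ Q * (σ ^ 2 * Q₂' / t') ^ (c₀ / 2) +
              C₂ lam c₀ c Q * σ ^ 2 / t' ∧
          condExcessRisk P (Ω' t) D (w t) wstar ≤
            (c₀ * C₁ d lam c δ Q₁' * Q₁' ^ (c₀ / 2) +
              c₀ * C₁ d lam c δ Q₁' * (σ ^ 2 * Q₂') ^ (c₀ / 2) +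
              C₂ lam c₀ c Q₁' * σ ^ 2) / t' := by
  have hlam0 : 0 < lam := hgap.trans_le hglam
  have hκ0 : 0 < κ := by
    have h1 : 0 ≤ κ := by
      obtain ⟨x, hx⟩ := hκ.exists
      exact (norm_nonneg x).trans hx
    refine h1.lt_of_ne fun h => ?_
    rw [← h] at hlamκ
    norm_num at hlamκ
    linarith
  have hcg : c * g = c₀ / 2 := by rw [hc]; field_simp
  have hc0 : 0 < c := by rw [hc]; positivity
  have hQ₁0 : 0 < Q₁' := (Q₁_pos hd hκ0 hδ0 hδ1).trans_le hQ₁'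
  have hv0 : 0 ≤ v := hv ▸ covNoise_nonneg _ _
  have hlog := log_four_div_ge hδ0 hδ1
  have hQ₂0 : 0 ≤ Q₂' := by
    refine le_trans ?_ hQ₂'
    have : 0 ≤ Real.log (4 / δ) := by linarith
    unfold Q₂
    positivity
  have hQQ : Q₁' ≤ Q := by rw [hQ]; exact le_add_of_nonneg_right (by positivity)
  have hQ0 : 0 < Q := hQ₁0.trans_le hQQ
  have hs := sq_mul_div_le_of_Q₁_le hd hκ0 hδ0 hδ1 (hQ₁'.trans hQQ)
  have hnoise := noise_le_of_Q₂_le hd hδ0 hδ1 hv0 hQ0 hQ₂' (by rw [hQ]; linarith)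
  have hed := exp_one_mul_ge hd
  have hd0 : (0 : ℝ) < d := by exact_mod_cast (by omega : 0 < d)
  -- Chosen so that the slab bound `a √d e ^ (1/2)` equals `δ / 2`.
  set a := δ / (2 * (Real.exp (1 / 2) * √d)) with ha
  have ha0 : 0 < a := by positivity
  have ha2 : a ^ 2 = δ ^ 2 / (4 * (Real.exp 1 * d)) := by
    rw [ha, div_pow, mul_pow, mul_pow, Real.sq_sqrt hd0.le, ← Real.exp_nat_mul]
    norm_num
  have ha4 : a ≤ 1 / 4 := by
    refine le_of_sq_le_sq ?_ (by norm_num)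
    rw [ha2, div_le_iff₀ (by positivity)]
    nlinarith
  have hcg1 : 1 ≤ c * g := by rw [hcg]; linarith
  have hcgκ : (c * g) ^ 2 ≤ c ^ 2 * κ ^ 4 := by
    have : c * g ≤ c * κ ^ 2 := by
      gcongr; linarith
    calc (c * g) ^ 2 ≤ (c * κ ^ 2) ^ 2 := by gcongr
      _ = _ := by ring
  obtain ⟨T, hT1, hT3⟩ :=
    exists_burn_in_time hQ0 hcg1 hcgκ hs ha0 ha4 hδ0 hδ1 hd ha2
  rw [hv] at hnoise
  have hprob : 1 - δ ≤ P.real (⋂ t, IsKrasulina.aligned e w T t) := by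
    refine hK.prob_aligned_ge hκ he hgap.le hc0.le hQ0 hs ha0 ha4 hδ0.le hstart ?_ hT1
    rw [div_pow, ha2]
    norm_num at hnoise ⊢
    exact hnoise
  have hpos : ∀ t, 0 < P.real (IsKrasulina.aligned e w T t) := fun t =>
    lt_of_lt_of_le (by linarith) (hprob.trans (measureReal_mono (Set.iInter_subset _ t)))
  refine ⟨IsKrasulina.aligned e w T,
    fun t => hK.innovation.le _ _ (hK.measurableSet_aligned e T t),
    IsKrasulina.aligned_antitone T, hprob, ?_⟩
  rintro t t' ht rfl hBt
  -- `c g ≥ 1` gives `c g ≤ (c g)² ≤ c² κ⁴`, so the bound `1/480` applies.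
  have hαQ : 4 / 3 * (c * g) / Q ≤ 1 / 2 := by
    refine le_trans (b := 4 / 3 * (c ^ 2 * κ ^ 4 / Q)) ?_ (by linarith)
    rw [← mul_div_assoc]
    refine div_le_div_of_nonneg_right ?_ hQ0.le
    nlinarith
  have hm := hK.condSinSq_le hκ he hgap.le hc0.le hQ0 rfl (by linarith) hαQ hpos t
  have hrisk := hK.condExcessRisk_le hκ he hgap.le (hpos t) hwstar0
  rw [← hv] at hm
  have hrate := hrisk.trans (rate_le (σ := σ) (d := d) (δ := δ) hlam0.le hc₀ (by rw [hcg]) hv0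
    hQ₁0 hQ₂0 hQ ht hB hvσ hT3 hBt hm)
  have htB : (1 : ℝ) ≤ ((t * B : ℕ) : ℝ) := by exact_mod_cast Nat.mul_pos ht hB
  exact ⟨hrate, hrate.trans (uniform_rate_le hlam0.le hc₀ hQ₁0 hQ₂0 hQQ htB)⟩

end DMKrasulina

open DMKrasulina in
theorem corollary1
    {Ω : Type*} [MeasurableSpace Ω] (P : Measure Ω) [IsProbabilityMeasure P]
    -- the data distribution: zero mean, bounded, positive eigengap
    (d : ℕ) (hd : 2 ≤ d)
    (D : Measure (Vec d)) [IsProbabilityMeasure D]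
    (κ : ℝ) (hκ : ∀ᵐ x ∂D, ‖x‖ ≤ κ)
    (hmean : ∫ x, x ∂D = 0)
    (hgap : 0 < gap D)
    -- the single-sample covariance noise variance
    (σ : ℝ) (hσ : sampleVar D ≤ σ ^ 2)
    -- the i.i.d. data stream and the independent uniform initialization on the unit sphere
    (z : ℕ → Ω → Vec d) (hz : ∀ k, Measurable (z k)) (hzlaw : ∀ k, P.map (z k) = D)
    (hzindep : iIndepFun z P)
    (w0 : Ω → Vec d) (hw0 : Measurable w0) (hw0law : P.map w0 = uniformSphere d)
    (hw0indep : IndepFun w0 (fun ω k => z k ω) P)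
    -- the number of nodes and the network-wide mini-batch size
    (N B : ℕ) (hN : 0 < N) (hB : 0 < B) (hNB : N ∣ B)
    -- the parameters of the algorithm
    (δ : ℝ) (hδ0 : 0 < δ) (hδ1 : δ < 1)
    (c₀ : ℝ) (hc₀ : 2 < c₀)
    (c : ℝ) (hc : c = c₀ / (2 * gap D))
    (Q₁' Q₂' Q : ℝ)
    (hQ₁' : Q₁ d κ c δ ≤ Q₁')
    (hQ₂' : Q₂ d (batchVar D N B) c δ / batchVar D N B ≤ Q₂')
    (hQ : Q = Q₁' + batchVar D N B * Q₂')
    -- a minimizer of the risk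
    (wstar : Vec d) (hwstar0 : wstar ≠ 0) (hwstar : IsMinOn (risk D) {0}ᶜ wstar) :
    ∃ Ω' : ℕ → Set Ω,
      (∀ t, MeasurableSet (Ω' t)) ∧ Antitone Ω' ∧ 1 - δ ≤ P.real (⋂ t, Ω' t) ∧
      ∀ t t' : ℕ, 0 < t → t' = t * B → (B : ℝ) ≤ (t' : ℝ) ^ (1 - 2 / c₀) →
        condExcessRisk P (Ω' t) D
            (fun ω => iterate N B (fun s => c / (Q + s)) (w0 ω) (fun k => z k ω) t) wstar ≤
            c₀ * C₁ d (eigval D 1) c δ Q * (Q₁' ^ (c₀ / 2) / t') +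
              c₀ * C₁ d (eigval D 1) c δ Q * (σ ^ 2 * Q₂' / t') ^ (c₀ / 2) +
              C₂ (eigval D 1) c₀ c Q * σ ^ 2 / t' ∧
          -- the rate `O(1/t')`, with a constant that depends neither on `t` nor on `N` and `B`
          condExcessRisk P (Ω' t) D
            (fun ω => iterate N B (fun s => c / (Q + s)) (w0 ω) (fun k => z k ω) t) wstar ≤
            (c₀ * C₁ d (eigval D 1) c δ Q₁' * Q₁' ^ (c₀ / 2) +
              c₀ * C₁ d (eigval D 1) c δ Q₁' * (σ ^ 2 * Q₂') ^ (c₀ / 2) +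
              C₂ (eigval D 1) c₀ c Q₁' * σ ^ 2) / t' := by
  obtain ⟨e, he⟩ := exists_isTopEigenvector hκ hd
  have hN' : 0 < B / N := Nat.div_pos (Nat.le_of_dvd hB hNB) hN
  have : Nonempty (Fin N × Fin (B / N)) := ⟨(⟨0, hN⟩, ⟨0, hN'⟩)⟩
  have hcard : (Fintype.card (Fin N × Fin (B / N)) : ℝ) = B := by
    rw [Fintype.card_prod, Fintype.card_fin, Fintype.card_fin, Nat.mul_div_cancel' hNB]
  have hbv := batchVar_eq_covNoise D hNB
  rw [hbv] at hQ₂' hQ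
  -- Time is counted in rounds: the past of round `t` is the initialization and the first `t * B`
  -- samples.
  have hK : IsKrasulina P D (fun t => history w0 z (t * B)) (batch N B z)
      (fun s => c / (Q + s))
      (fun t ω => iterate N B (fun s => c / (Q + s)) (w0 ω) (fun k => z k ω) t) :=
    { innovation := isInnovation_batch hz hzlaw hzindep hw0 hw0indep hNB
      measurable := measurable_iterate N B _ hNB
      succ := fun t ω => iterate_succ_eq N B _ t ω
      norm_init := by
        have h1 := ae_uniformSphere_norm_eq d
        rw [← hw0law] at h1
        exact ae_of_ae_map hw0.aemeasurable h1 }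
  have hd0 : (0 : ℝ) < d := by exact_mod_cast (by omega : 0 < d)
  refine hK.exists_events_rate hd hκ he hgap (he.gap_le hd) (eigval_one_le_sq hκ he) hB hδ0 hδ1
    hc₀ hc rfl ?_ hQ₁' hQ₂' hQ ?_ hwstar0
  · rw [covNoise_eq hκ, hcard]
    gcongr
  · have h1 := uniformSphere_slab_le (by omega : 0 < d) he.norm_eq
      (show 0 < δ / (2 * (Real.exp (1 / 2) * √d)) by positivity)
    rw [← hw0law, Measure.map_apply hw0
      (measurableSet_lt (by fun_prop) measurable_const)] at h1
    refine h1.trans (ENNReal.ofReal_le_ofReal (le_of_eq ?_))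
    field_simp
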